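/- Let $N\ge 2$ be an even integer and consider a chain of $N$ spins one, with Hilbert space $(\mathbb{C}^3)^{\otimes N}$, located at the sites $\eta_\alpha=e^{2\pi \mathrm{i}\alpha/N}$ ($\alpha=1,\dots,N$) of the unit circle. Let $\boldsymbol{S}_\alpha=(S^x_\alpha,S^y_\alpha,S^z_\alpha)$ be the spin-one operators on site $\alpha$, $S^\pm_\alpha=S^x_\alpha\pm \mathrm{i}S^y_\alpha$, $\tilde S^+_\alpha=\tfrac12(S^z_\alpha+1)S^+_\alpha$, and let $|{-1}\rangle_N=\bigotimes_{\alpha}|1,-1\rangle_\alpha$ be the state with $S^z_\alpha=-1$ on all sites. Let $$\psi_0(z_1,\dots,z_N)=\mathrm{Pf}\Big(\frac1{z_i-z_j}\Big)\prod_{i<j}(z_i-z_j)\prod_{i=1}^N z_i ,$$ which is a symmetric polynomial in $z_1,\dots,z_N$ (so that it also has a value at coinciding coordinates), and let $$|\psi_0\rangle=\sum_{z_1,\dots,z_N}\psi_0(z_1,\dots,z_N)\,\tilde S^+_{z_1}\cdots\tilde S^+_{z_N}|{-1}\rangle_N ,$$ where each $z_i$ runs independently over the $N$ sites. Then: 1.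 $|\psi_0\rangle\neq0$, and $|\psi_0\rangle$ is an eigenvector of $$H=\frac{2\pi^2}{N^2}\Bigg[\sum_{\alpha\ne\beta}\frac{\boldsymbol{S}_\alpha\cdot\boldsymbol{S}_\beta}{|\eta_\alpha-\eta_\beta|^2}-\frac1{20}\sum_{\substack{\alpha,\beta,\gamma\\ \beta\ne\alpha,\ \gamma\neq\alpha}}\frac{(\boldsymbol{S}_\alpha\cdot\boldsymbol{S}_\beta)(\boldsymbol{S}_\alpha\cdot\boldsymbol{S}_\gamma)+(\boldsymbol{S}_\alpha\cdot\boldsymbol{S}_\gamma)(\boldsymbol{S}_\alpha\cdot\boldsymbol{S}_\beta)}{(\bar\eta_\alpha-\bar\eta_\beta)(\eta_\alpha-\eta_\gamma)}\Bigg]$$ (the terms with $\beta=\gamma$ are included) with eigenvalue $-\dfrac{2\pi^2}{15}\Big(N+\dfrac5N\Big)$. 2. For every $\alpha$, the operator $$\Omega_\alpha=\sum_{\beta\ne\alpha}\frac{(S^-_\alpha)^2S^-_\beta}{\eta_\alpha-\eta_\beta}$$ satisfies $\Omega_\alpha|\psi_0\rangle=0$, and so does the operator $\bar\Omega_\alpha$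 obtained by replacing the coefficients with their complex conjugates. 3. For every $\alpha$, the operator $$\Xi_\alpha=\sum_{\beta\ne\alpha}\sum_{\gamma\ne\alpha}\frac{S^-_\alpha S^-_\beta S^-_\gamma}{(\eta_\alpha-\eta_\beta)(\eta_\alpha-\eta_\gamma)}-\sum_{\beta\neq\alpha}\frac{(S^-_\alpha)^2S^-_\beta}{(\eta_\alpha-\eta_\beta)^2}$$ (the terms with $\beta=\gamma$ are included) satisfies $\Xi_\alpha|\psi_0\rangle=0$, and so does the operator $\bar\Xi_\alpha$ obtained by replacing the coefficients with their complex conjugates. -/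

import Mathlib

open Matrix ComplexConjugate

namespace PfaffianChain

/-! ### The Pfaffian and the wave function -/

/-- The Pfaffian of an (antisymmetric) `2n × 2n` matrix,
`Pf A = (1 / (2ⁿ n!)) ∑_σ sgn σ ∏_k A_{σ(2k), σ(2k+1)}`: the antisymmetrized sum over all
pairings of the indices, each pairing counted once. -/
noncomputable def pfaffian {n : ℕ} (A : Matrix (Fin (2 * n)) (Fin (2 * n)) ℂ) : ℂ :=
  (1 / (2 ^ n * (n.factorial : ℂ))) *
    ∑ σ : Equiv.Perm (Fin (2 * n)), ((Equiv.Perm.sign σ : ℤ) : ℂ) *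
      ∏ k : Fin n, A (σ ⟨2 * k, by omega⟩) (σ ⟨2 * k + 1, by omega⟩)

/-- The Vandermonde product `∏_{i<j} (z_i - z_j)`. -/
noncomputable def vandermondeProd {N : ℕ} (z : Fin N → ℂ) : ℂ :=
  ∏ i, ∏ j ∈ Finset.Ioi i, (z i - z j)

/-- The polynomial `Pf(1/(z_i - z_j)) ∏_{i<j} (z_i - z_j)`. In each term of the Pfaffian the
denominators `z_{σ(2k)} - z_{σ(2k+1)}` are cancelled against the Vandermonde product
(`sgn σ ∏_{i<j} (z_i - z_j) = ∏_{i<j} (z_{σ(i)} - z_{σ(j)})`), so that the expression also has its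
correct value at coinciding coordinates; see `pfaffianVandermonde_eq` for the agreement with the
quotient form at pairwise distinct ones. -/
noncomputable def pfaffianVandermonde {n : ℕ} (z : Fin (2 * n) → ℂ) : ℂ :=
  (1 / (2 ^ n * (n.factorial : ℂ))) *
    ∑ σ : Equiv.Perm (Fin (2 * n)),
      ∏ i : Fin (2 * n), ∏ j ∈ Finset.Ioi i with (i : ℕ) / 2 ≠ (Fin.val j) / 2, (z (σ i) - z (σ j))

/-- The spin liquid wave function
`ψ₀(z₁,…,z_N) = Pf(1/(z_i - z_j)) ∏_{i<j} (z_i - z_j) ∏_i z_i`, with `N = 2n`. -/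
noncomputable def waveFunction {n : ℕ} (z : Fin (2 * n) → ℂ) : ℂ :=
  pfaffianVandermonde z * ∏ i, z i

theorem vandermondeProd_perm {N : ℕ} (z : Fin N → ℂ) (σ : Equiv.Perm (Fin N)) :
    vandermondeProd (fun i => z (σ i)) = ((Equiv.Perm.sign σ : ℤ) : ℂ) * vandermondeProd z := by
  exact σ.prod_Ioi_comp_eq_sign_mul_prod (f := fun i j => z i - z j) (fun i j => by ring)

theorem vandermondeProd_split {n : ℕ} (z : Fin (2 * n) → ℂ) :
    vandermondeProd z =
      (∏ k : Fin n, (z ⟨2 * k, by omega⟩ - z ⟨2 * k + 1, by omega⟩)) *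
      ∏ i : Fin (2 * n), ∏ j ∈ Finset.Ioi i with (i : ℕ) / 2 ≠ (Fin.val j) / 2, (z i - z j) := by
  have h1 : vandermondeProd z =
      (∏ i : Fin (2 * n), ∏ j ∈ Finset.Ioi i with (i : ℕ) / 2 = (Fin.val j) / 2, (z i - z j)) *
      ∏ i : Fin (2 * n), ∏ j ∈ Finset.Ioi i with (i : ℕ) / 2 ≠ (Fin.val j) / 2, (z i - z j) := by
    rw [← Finset.prod_mul_distrib]
    exact Finset.prod_congr rfl fun i _ => (Finset.prod_filter_mul_prod_filter_not _ _ _).symm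
  rw [h1]
  congr 1
  rw [Finset.prod_sigma']
  symm
  refine Finset.prod_bij
    (fun (k : Fin n) _ => (⟨⟨2 * k, by omega⟩, ⟨2 * k + 1, by omega⟩⟩ :
      Σ _ : Fin (2 * n), Fin (2 * n))) ?_ ?_ ?_ ?_
  · intro k _
    simp only [Finset.mem_sigma, Finset.mem_univ, Finset.mem_filter, Finset.mem_Ioi, true_and]
    exact ⟨by simp [Fin.lt_def], by omega⟩
  · intro k _ l _ h
    have h2 := congrArg (fun x : Σ _ : Fin (2 * n), Fin (2 * n) => (x.1 : ℕ)) h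
    simp only at h2
    exact Fin.ext (by omega)
  · rintro ⟨i, j⟩ h
    simp only [Finset.mem_sigma, Finset.mem_univ, Finset.mem_filter, Finset.mem_Ioi, true_and,
      Fin.lt_def] at h
    have hi : 2 * ((i : ℕ) / 2) = i := by omega
    have hj : (i : ℕ) + 1 = j := by omega
    refine ⟨⟨(i : ℕ) / 2, by omega⟩, Finset.mem_univ _, ?_⟩
    simp only [hi, hj]
  · intro k _
    rfl

/-- At pairwise distinct coordinates, `pfaffianVandermonde` is literally
`Pf(1/(z_i - z_j)) ∏_{i<j} (z_i - z_j)`. -/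
theorem pfaffianVandermonde_eq {n : ℕ} (z : Fin (2 * n) → ℂ) (hz : Function.Injective z) :
    pfaffianVandermonde z =
      pfaffian (Matrix.of fun i j => 1 / (z i - z j)) * vandermondeProd z := by
  unfold pfaffianVandermonde pfaffian
  rw [mul_assoc, Finset.sum_mul]
  congr 1
  refine Finset.sum_congr rfl fun σ _ => ?_
  have h := vandermondeProd_perm z σ
  rw [vandermondeProd_split (fun i => z (σ i))] at h
  have hne : (∏ k : Fin n, (z (σ ⟨2 * k, by omega⟩) - z (σ ⟨2 * k + 1, by omega⟩))) ≠ 0 := by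
    refine Finset.prod_ne_zero_iff.mpr fun k _ => sub_ne_zero.mpr fun e => ?_
    simpa [Fin.ext_iff] using σ.injective (hz e)
  simp only [Matrix.of_apply, one_div, Finset.prod_inv_distrib]
  rw [mul_right_comm, ← h, mul_right_comm, mul_inv_cancel₀ hne, one_mul]

/-- `pfaffianVandermonde` is continuous; with `pfaffianVandermonde_eq` this determines it. -/
theorem continuous_pfaffianVandermonde (n : ℕ) :
    Continuous (pfaffianVandermonde : (Fin (2 * n) → ℂ) → ℂ) := by
  unfold pfaffianVandermonde
  fun_prop

/-! ### The chain of `N` spins one -/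

/-- Product basis of `(ℂ³)^{⊗N}`. At each site, `0, 1, 2 : Fin 3` stand for the states
`|1,1⟩, |1,0⟩, |1,-1⟩`. -/
abbrev Config (N : ℕ) := Fin N → Fin 3

/-- State vectors of the chain, by their amplitudes in the product basis. -/
abbrev State (N : ℕ) := Config N → ℂ

/-- Linear operators on the chain, as matrices in the product basis. -/
abbrev Op (N : ℕ) := Matrix (Config N) (Config N) ℂ

/-- The lattice sites `η_α = e^{2πiα/N}` on the unit circle (`α = 0` is the site `α = N`). -/
noncomputable def eta (N : ℕ) (α : Fin N) : ℂ :=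
  Complex.exp (2 * Real.pi * Complex.I * (α : ℕ) / N)

/-- The spin-one matrices. -/
noncomputable def sz : Matrix (Fin 3) (Fin 3) ℂ := !![1, 0, 0; 0, 0, 0; 0, 0, -1]

noncomputable def sp : Matrix (Fin 3) (Fin 3) ℂ :=
  !![0, (Real.sqrt 2 : ℂ), 0; 0, 0, (Real.sqrt 2 : ℂ); 0, 0, 0]

noncomputable def sm : Matrix (Fin 3) (Fin 3) ℂ :=
  !![0, 0, 0; (Real.sqrt 2 : ℂ), 0, 0; 0, (Real.sqrt 2 : ℂ), 0]

noncomputable def sx : Matrix (Fin 3) (Fin 3) ℂ := (1 / 2 : ℂ) • (sp + sm)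

noncomputable def sy : Matrix (Fin 3) (Fin 3) ℂ := (1 / (2 * Complex.I) : ℂ) • (sp - sm)

/-- The one-site operator `A` acting on site `α`, i.e. `1 ⊗ ⋯ ⊗ A ⊗ ⋯ ⊗ 1`. -/
def site {N : ℕ} (α : Fin N) (A : Matrix (Fin 3) (Fin 3) ℂ) : Op N :=
  Matrix.of fun s t => if ∀ β, β ≠ α → s β = t β then A (s α) (t α) else 0

noncomputable def Sx {N : ℕ} (α : Fin N) : Op N := site α sx
noncomputable def Sy {N : ℕ} (α : Fin N) : Op N := site α sy
noncomputable def Sz {N : ℕ} (α : Fin N) : Op N := site α sz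
noncomputable def Sp {N : ℕ} (α : Fin N) : Op N := site α sp
noncomputable def Sm {N : ℕ} (α : Fin N) : Op N := site α sm

/-- The scalar product `𝐒_α · 𝐒_β`. -/
noncomputable def dotS {N : ℕ} (α β : Fin N) : Op N :=
  Sx α * Sx β + Sy α * Sy β + Sz α * Sz β

/-- The renormalized spin flip `S̃⁺_α = ((Sᶻ_α + 1) / 2) S⁺_α`. -/
noncomputable def Stilde {N : ℕ} (α : Fin N) : Op N :=
  ((1 / 2 : ℂ) • (Sz α + 1)) * Sp α

/-- The vacuum `|-1⟩_N = ⊗_α |1,-1⟩_α`. -/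
def vacuum (N : ℕ) : State N := Pi.single (fun _ => 2) 1

/-- The spin liquid state
`|ψ₀⟩ = ∑_{z₁,…,z_N} ψ₀(z₁,…,z_N) S̃⁺_{z₁} ⋯ S̃⁺_{z_N} |-1⟩_N`, where each of the coordinates
`z_i` runs independently over the `N = 2n` lattice sites. -/
noncomputable def psi0 (n : ℕ) : State (2 * n) :=
  ∑ a : Fin (2 * n) → Fin (2 * n),
    waveFunction (fun i => eta (2 * n) (a i)) •
      ((List.ofFn fun i => Stilde (a i)).prod *ᵥ vacuum (2 * n))

/-! ### The operators -/

/-- The Hamiltonian `H^{S=1}`; in the triple sum `β = γ` is allowed. -/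
noncomputable def hamiltonian (N : ℕ) : Op N :=
  (2 * (Real.pi : ℂ) ^ 2 / (N : ℂ) ^ 2) •
    ((∑ α, ∑ β ∈ Finset.univ.erase α,
        (1 / ((‖eta N α - eta N β‖ ^ 2 : ℝ) : ℂ)) • dotS α β) -
      (1 / 20 : ℂ) •
        ∑ α, ∑ β ∈ Finset.univ.erase α, ∑ γ ∈ Finset.univ.erase α,
          (1 / ((conj (eta N α) - conj (eta N β)) * (eta N α - eta N γ))) •
            (dotS α β * dotS α γ + dotS α γ * dotS α β))

/-- `Ω_α = ∑_{β ≠ α} (S⁻_α)² S⁻_β / (η_α - η_β)`. -/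
noncomputable def Omega (N : ℕ) (α : Fin N) : Op N :=
  ∑ β ∈ Finset.univ.erase α, (1 / (eta N α - eta N β)) • (Sm α ^ 2 * Sm β)

/-- `Ω̄_α`: the coefficients of `Ω_α` are replaced by their complex conjugates. -/
noncomputable def OmegaBar (N : ℕ) (α : Fin N) : Op N :=
  ∑ β ∈ Finset.univ.erase α,
    (1 / (conj (eta N α) - conj (eta N β))) • (Sm α ^ 2 * Sm β)

/-- `Ξ_α = ∑_{β,γ ≠ α} S⁻_α S⁻_β S⁻_γ / ((η_α - η_β)(η_α - η_γ))
  - ∑_{β ≠ α} (S⁻_α)² S⁻_β / (η_α - η_β)²`; in the double sum `β = γ` is allowed. -/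
noncomputable def Xi (N : ℕ) (α : Fin N) : Op N :=
  (∑ β ∈ Finset.univ.erase α, ∑ γ ∈ Finset.univ.erase α,
      (1 / ((eta N α - eta N β) * (eta N α - eta N γ))) • (Sm α * Sm β * Sm γ)) -
    ∑ β ∈ Finset.univ.erase α, (1 / (eta N α - eta N β) ^ 2) • (Sm α ^ 2 * Sm β)

/-- `Ξ̄_α`: the coefficients of `Ξ_α` are replaced by their complex conjugates. -/
noncomputable def XiBar (N : ℕ) (α : Fin N) : Op N :=
  (∑ β ∈ Finset.univ.erase α, ∑ γ ∈ Finset.univ.erase α,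
      (1 / ((conj (eta N α) - conj (eta N β)) * (conj (eta N α) - conj (eta N γ)))) •
        (Sm α * Sm β * Sm γ)) -
    ∑ β ∈ Finset.univ.erase α,
      (1 / (conj (eta N α) - conj (eta N β)) ^ 2) • (Sm α ^ 2 * Sm β)

end PfaffianChain

namespace PfaffianChain

/-! ### One-site operators -/

section SiteAlgebra

variable {N : ℕ}

/-! With N = 2n, ψ₀ is the restriction to the lattice of a symmetric polynomial P whose exponents
lie between 1 and N-1 and which vanishes when three coordinates coincide (`isLatticePoly_wavePoly`).
The normalization of S̃⁺ makes S⁻_α act by fixing one coordinate at η_α (`Sm_mulVec_ket`), so Ω_α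
and Ξ_α become weighted lattice sums of values of P. For 1 ≤ k ≤ N the sum of η_β^k/(η_α-η_β) over β
≠ α is η_α^(k-1)(k-(N+1)/2), and squared denominators give a quadratic in k. The sums are therefore
moments of the exponents k, l, m of three coordinates, taken where these coincide. By symmetry of P
they reduce to moments of 1, k+l+m and (k+l+m)², which vanish because P(t,t,t,b) is zero identically
in t (`IsLatticePoly.moment_quadratic`). Conjugating the weights only shifts exponents.

For the energy, ψ₀ is a singlet. Fix α and let K, L, M be the sums over β ≠ α of S_β with weights
1/(η_α-η_β), their conjugates, and the products of the two. The components of ψ₀ at the site α form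
a triplet for the rest of the chain, and Ω_α ψ₀ = 0 kills the spin-two coupling of K to this
triplet; likewise Ω̄_α for L. This gives {S_α·L, S_α·K}ψ₀ = (8 L·K + 4 S_α·M)ψ₀
(`dotEnv_mul_dotEnv_mulVec`). After summation over α the 1/|η_β-η_γ|² interactions cancel, leaving
the total spin squared, which vanishes on a singlet, and a constant (`sum_dotEnv_eq`).

Finally ψ₀ ≠ 0: an admissible wave function is determined by its state
(`IsAdmissible.eq_zero_of_ket_eq_zero`), and where n sites are doubly occupied the terms of ψ₀
cannot cancel (`waveFunction_block_ne_zero`). -/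

theorem site_mulVec (α : Fin N) (A : Matrix (Fin 3) (Fin 3) ℂ) (f : State N) (s : Config N) :
    (site α A *ᵥ f) s = ∑ m, A (s α) m * f (Function.update s α m) := by
  classical
  have h : ∀ m : Fin 3, A (s α) m * f (Function.update s α m) =
      ∑ t : Config N, if t = Function.update s α m then A (s α) (t α) * f t else 0 := by
    intro m
    rw [Finset.sum_ite_eq']
    simp
  simp only [h, Matrix.mulVec, dotProduct, site, Matrix.of_apply, ite_mul, zero_mul]
  rw [Finset.sum_comm]
  refine Finset.sum_congr rfl fun t _ => ?_
  by_cases ht : ∀ β, β ≠ α → s β = t β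
  · rw [if_pos ht]
    have : ∀ m, (t = Function.update s α m) ↔ m = t α := by
      intro m
      constructor
      · intro e; rw [e]; simp
      · rintro rfl
        ext β
        by_cases hb : β = α
        · subst hb; simp
        · simp [Function.update_of_ne hb, ht β hb]
    simp [this]
  · rw [if_neg ht]
    refine (Finset.sum_eq_zero fun m _ => ?_).symm
    rw [if_neg]
    rintro rfl
    exact ht fun β hb => by simp [Function.update_of_ne hb]

theorem op_ext {A B : Op N} (h : ∀ f : State N, A *ᵥ f = B *ᵥ f) : A = B :=
  Matrix.mulVec_injective (funext h)

theorem site_mul (α : Fin N) (A B : Matrix (Fin 3) (Fin 3) ℂ) :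
    site α A * site α B = site α (A * B) := by
  refine op_ext fun f => funext fun s => ?_
  rw [← Matrix.mulVec_mulVec]
  simp only [site_mulVec, Function.update_self, Function.update_idem, Matrix.mul_apply,
    Finset.mul_sum, Finset.sum_mul]
  rw [Finset.sum_comm]
  simp only [mul_assoc]

theorem site_add (α : Fin N) (A B : Matrix (Fin 3) (Fin 3) ℂ) :
    site α (A + B) = site α A + site α B := by
  refine op_ext fun f => funext fun s => ?_
  rw [Matrix.add_mulVec, Pi.add_apply, site_mulVec, site_mulVec, site_mulVec,
    ← Finset.sum_add_distrib]
  simp only [Matrix.add_apply, add_mul]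

theorem site_smul (α : Fin N) (c : ℂ) (A : Matrix (Fin 3) (Fin 3) ℂ) :
    site α (c • A) = c • site α A := by
  ext s t
  by_cases h : ∀ β, β ≠ α → s β = t β <;> simp [site, h]

theorem site_sub (α : Fin N) (A B : Matrix (Fin 3) (Fin 3) ℂ) :
    site α (A - B) = site α A - site α B := by
  refine op_ext fun f => funext fun s => ?_
  rw [Matrix.sub_mulVec, Pi.sub_apply, site_mulVec, site_mulVec, site_mulVec,
    ← Finset.sum_sub_distrib]
  simp only [Matrix.sub_apply, sub_mul]

theorem site_one (α : Fin N) : site α (1 : Matrix (Fin 3) (Fin 3) ℂ) = (1 : Op N) := by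
  refine op_ext fun f => funext fun s => ?_
  rw [site_mulVec]
  simp [Matrix.one_apply]

theorem site_commute {α β : Fin N} (h : α ≠ β) (A B : Matrix (Fin 3) (Fin 3) ℂ) :
    site α A * site β B = site β B * site α A := by
  refine op_ext fun f => funext fun s => ?_
  simp only [← Matrix.mulVec_mulVec, site_mulVec, Function.update_of_ne h,
    Function.update_of_ne h.symm, Finset.mul_sum]
  rw [Finset.sum_comm]
  refine Finset.sum_congr rfl fun m _ => Finset.sum_congr rfl fun k _ => ?_
  rw [Function.update_comm h]
  ring

theorem site_conjTranspose (α : Fin N) (A : Matrix (Fin 3) (Fin 3) ℂ) :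
    (site α A)ᴴ = site α Aᴴ := by
  ext s t
  have : (∀ β, β ≠ α → t β = s β) ↔ (∀ β, β ≠ α → s β = t β) :=
    forall₂_congr fun _ _ => eq_comm
  by_cases h : ∀ β, β ≠ α → s β = t β
  · simp only [site, Matrix.conjTranspose_apply, Matrix.of_apply]
    rw [if_pos h, if_pos (this.2 h)]
  · simp only [site, Matrix.conjTranspose_apply, Matrix.of_apply]
    rw [if_neg h, if_neg (mt this.1 h), star_zero]

end SiteAlgebra

/-! ### Product states -/

section ProdState

variable {N : ℕ}

/-- The product state with the one-site state `g α` at the site `α`. -/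
def prodState (g : Fin N → Fin 3 → ℂ) : State N := fun s => ∏ α, g α (s α)

theorem site_mulVec_prodState (α : Fin N) (A : Matrix (Fin 3) (Fin 3) ℂ)
    (g : Fin N → Fin 3 → ℂ) :
    site α A *ᵥ prodState g = prodState (Function.update g α (A *ᵥ g α)) := by
  ext s
  rw [site_mulVec]
  simp only [prodState]
  rw [← Finset.mul_prod_erase _ _ (Finset.mem_univ α)]
  have h1 : ∀ m, ∏ β, g β (Function.update s α m β) =
      g α m * ∏ β ∈ Finset.univ.erase α, g β (s β) := by
    intro m
    rw [← Finset.mul_prod_erase _ _ (Finset.mem_univ α)]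
    congr 1
    · simp
    · refine Finset.prod_congr rfl fun β hβ => ?_
      rw [Function.update_of_ne (Finset.ne_of_mem_erase hβ)]
  have h2 : ∏ β ∈ Finset.univ.erase α, Function.update g α (A *ᵥ g α) β (s β) =
      ∏ β ∈ Finset.univ.erase α, g β (s β) := by
    refine Finset.prod_congr rfl fun β hβ => ?_
    rw [Function.update_of_ne (Finset.ne_of_mem_erase hβ)]
  simp only [h1, h2, Function.update_self, Matrix.mulVec, dotProduct, Finset.sum_mul, mul_assoc]

theorem prodState_update_smul (α : Fin N) (g : Fin N → Fin 3 → ℂ) (c : ℂ) (v : Fin 3 → ℂ) :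
    prodState (Function.update g α (c • v)) = c • prodState (Function.update g α v) := by
  ext s
  simp only [prodState, Pi.smul_apply, smul_eq_mul]
  rw [← Finset.mul_prod_erase _ _ (Finset.mem_univ α),
    ← Finset.mul_prod_erase _ (fun β => Function.update g α v β (s β)) (Finset.mem_univ α),
    ← mul_assoc]
  congr 1
  · simp
  · refine Finset.prod_congr rfl fun β hβ => ?_
    rw [Function.update_of_ne (Finset.ne_of_mem_erase hβ),
      Function.update_of_ne (Finset.ne_of_mem_erase hβ)]

/-- The one-site renormalized spin flip. -/
noncomputable def stilde : Matrix (Fin 3) (Fin 3) ℂ := ((1 / 2 : ℂ) • (sz + 1)) * sp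

theorem Stilde_eq_site (α : Fin N) : Stilde α = site α stilde := by
  rw [Stilde, stilde, ← site_mul, site_smul, site_add, site_one, Sz, Sp]

theorem sqrt_two_mul_self : (Real.sqrt 2 : ℂ) * (Real.sqrt 2 : ℂ) = 2 := by
  rw [← Complex.ofReal_mul, Real.mul_self_sqrt (by norm_num)]
  norm_num

/-- The one-site state with `k` flips applied to `|1,-1⟩`. -/
noncomputable def flipped (k : ℕ) : Fin 3 → ℂ := stilde ^ k *ᵥ Pi.single 2 1

theorem stilde_eq : stilde =
    !![0, (Real.sqrt 2 : ℂ), 0; 0, 0, (Real.sqrt 2 : ℂ) / 2; 0, 0, 0] := by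
  ext i j
  fin_cases i <;> fin_cases j <;>
    simp [stilde, sz, sp, Matrix.mul_apply, Fin.sum_univ_three, Matrix.one_apply] <;> ring

theorem flipped_zero : flipped 0 = ![0, 0, 1] := by
  ext i; fin_cases i <;> simp [flipped]

theorem stilde_mulVec_flipped (k : ℕ) : stilde *ᵥ flipped k = flipped (k + 1) := by
  rw [flipped, flipped, pow_succ', Matrix.mulVec_mulVec]

theorem flipped_one : flipped 1 = ![0, (Real.sqrt 2 : ℂ) / 2, 0] := by
  rw [← stilde_mulVec_flipped, flipped_zero, stilde_eq]
  ext i; fin_cases i <;> simp [Matrix.mulVec, dotProduct, Fin.sum_univ_three]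

theorem flipped_two : flipped 2 = ![1, 0, 0] := by
  rw [← stilde_mulVec_flipped, flipped_one, stilde_eq]
  have := sqrt_two_mul_self
  ext i; fin_cases i <;> simp [Matrix.mulVec, dotProduct, Fin.sum_univ_three]
  linear_combination (1 / 2 : ℂ) * this

theorem flipped_add_three (k : ℕ) : flipped (k + 3) = 0 := by
  induction k with
  | zero =>
    rw [← stilde_mulVec_flipped, flipped_two, stilde_eq]
    ext i; fin_cases i <;> simp [Matrix.mulVec, dotProduct, Fin.sum_univ_three]
  | succ k ih =>
    rw [show k + 1 + 3 = (k + 3) + 1 by ring, ← stilde_mulVec_flipped, ih, Matrix.mulVec_zero]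

theorem sz_mulVec_flipped (k : ℕ) : sz *ᵥ flipped k = ((k : ℂ) - 1) • flipped k := by
  match k with
  | 0 =>
    rw [flipped_zero]
    ext i; fin_cases i <;> simp [Matrix.mulVec, dotProduct, Fin.sum_univ_three, sz]
  | 1 =>
    rw [flipped_one]
    ext i; fin_cases i <;> simp [Matrix.mulVec, dotProduct, Fin.sum_univ_three, sz]
  | 2 =>
    rw [flipped_two]
    ext i; fin_cases i <;> simp [Matrix.mulVec, dotProduct, Fin.sum_univ_three, sz]
    norm_num
  | k + 3 => rw [flipped_add_three]; simp

theorem sm_mulVec_flipped_zero : sm *ᵥ flipped 0 = 0 := by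
  rw [flipped_zero]
  ext i; fin_cases i <;> simp [Matrix.mulVec, dotProduct, Fin.sum_univ_three, sm]

/-- This is the purpose of the factor (Sᶻ+1)/2: it halves the first flip, so that S⁻ acts as
differentiation on powers of S̃⁺. The rule breaks down at the third power, where S̃⁺ already gives
zero. -/
theorem sm_mulVec_flipped_succ (k : ℕ) (hk : k < 2) :
    sm *ᵥ flipped (k + 1) = ((k : ℂ) + 1) • flipped k := by
  have := sqrt_two_mul_self
  match k with
  | 0 =>
    rw [flipped_zero, zero_add, flipped_one]
    ext i; fin_cases i <;> simp [Matrix.mulVec, dotProduct, Fin.sum_univ_three, sm]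
    linear_combination (1 / 2 : ℂ) * this
  | 1 =>
    rw [flipped_one, one_add_one_eq_two, flipped_two]
    ext i; fin_cases i <;> simp [Matrix.mulVec, dotProduct, Fin.sum_univ_three, sm]
    ring
  | k + 2 => omega

end ProdState

/-! ### States defined by wave functions -/

section Ket

variable {N : ℕ}

/-- The number of particles of `a` at the site `α`. -/
def occ {M : ℕ} (a : Fin M → Fin N) (α : Fin N) : ℕ := ∑ i, if a i = α then 1 else 0

theorem occ_succAbove {M : ℕ} (a : Fin (M + 1) → Fin N) (i : Fin (M + 1)) (α : Fin N) :
    occ a α = (if a i = α then 1 else 0) + occ (fun j => a (i.succAbove j)) α := by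
  simp only [occ]
  rw [Fin.sum_univ_succAbove _ i]

/-- `S̃⁺_{a 0} ⋯ S̃⁺_{a (M-1)} |-1⟩`. -/
noncomputable def flipState {M : ℕ} (a : Fin M → Fin N) : State N :=
  (List.ofFn fun i => Stilde (a i)).prod *ᵥ vacuum N

theorem flipState_eq_prodState {M : ℕ} (a : Fin M → Fin N) :
    flipState a = prodState fun α => flipped (occ a α) := by
  induction M with
  | zero =>
    ext s
    simp only [flipState, List.ofFn_zero, List.prod_nil, Matrix.one_mulVec, vacuum, prodState, occ,
      Finset.univ_eq_empty, Finset.sum_empty, flipped, pow_zero, Pi.single_apply]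
    by_cases h : s = fun _ => 2
    · subst h; simp
    · rw [if_neg h]
      obtain ⟨β, hβ⟩ := Function.ne_iff.mp h
      exact (Finset.prod_eq_zero (Finset.mem_univ β) (by simp [hβ])).symm
  | succ M ih =>
    have h := ih (fun i => a i.succ)
    rw [flipState] at h ⊢
    rw [List.ofFn_succ, List.prod_cons, ← Matrix.mulVec_mulVec, h, Stilde_eq_site,
      site_mulVec_prodState]
    congr 1
    ext1 α
    by_cases hα : α = a 0
    · subst hα
      rw [Function.update_self, stilde_mulVec_flipped]
      congr 1
      rw [occ_succAbove a 0, if_pos rfl, add_comm]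
      rfl
    · rw [Function.update_of_ne hα]
      congr 1
      rw [occ_succAbove a 0, if_neg (Ne.symm hα), zero_add]
      rfl

/-- The state with the (not necessarily symmetric) wave function `ψ`. -/
noncomputable def ket {M : ℕ} (ψ : (Fin M → Fin N) → ℂ) : State N :=
  ∑ a, ψ a • flipState a

/-- Symmetric wave functions that vanish if three coordinates coincide. -/
structure IsAdmissible {M : ℕ} (ψ : (Fin M → Fin N) → ℂ) : Prop where
  symm : ∀ (σ : Equiv.Perm (Fin M)) a, ψ (fun i => a (σ i)) = ψ a
  triple : ∀ a α, 3 ≤ occ a α → ψ a = 0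

theorem IsAdmissible.cons {M : ℕ} {ψ : (Fin (M + 1) → Fin N) → ℂ} (h : IsAdmissible ψ)
    (α : Fin N) : IsAdmissible fun b : Fin M → Fin N => ψ (Fin.cons α b) where
  symm σ b := by
    -- The permutation that fixes 0 and acts as σ on the remaining positions.
    have := h.symm (Equiv.Perm.decomposeFin.symm (0, σ)) (Fin.cons α b)
    rw [← this]
    congr 1
    ext1 i
    refine Fin.cases ?_ (fun j => ?_) i <;> simp
  triple b β hb := by
    refine h.triple _ β ?_
    rw [occ_succAbove _ 0]
    simp only [Fin.zero_succAbove, Fin.cons_succ]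
    exact le_add_left hb

theorem Sm_mulVec_flipState {M : ℕ} (α : Fin N) (a : Fin (M + 1) → Fin N) (ha : occ a α ≤ 2) :
    Sm α *ᵥ flipState a =
      ∑ i, if a i = α then flipState (fun j => a (i.succAbove j)) else 0 := by
  have key : ∀ i, a i = α → flipState (fun j => a (i.succAbove j)) =
      prodState (Function.update (fun β => flipped (occ a β)) α (flipped (occ a α - 1))) := by
    intro i hi
    rw [flipState_eq_prodState]
    congr 1
    ext1 β
    have := occ_succAbove a i β
    by_cases hβ : β = α
    · subst hβ
      rw [Function.update_self, this, if_pos hi, Nat.add_sub_cancel_left]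
    · rw [Function.update_of_ne hβ, this, if_neg (by rw [hi]; exact Ne.symm hβ), zero_add]
  have h1 : (∑ i, if a i = α then flipState (fun j => a (i.succAbove j)) else 0) =
      ∑ i, (if a i = α then (1 : ℂ) else 0) •
        prodState (Function.update (fun β => flipped (occ a β)) α (flipped (occ a α - 1))) := by
    refine Finset.sum_congr rfl fun i _ => ?_
    by_cases hi : a i = α
    · rw [if_pos hi, if_pos hi, key i hi, one_smul]
    · rw [if_neg hi, if_neg hi, zero_smul]
  have h2 : (∑ i, if a i = α then (1 : ℂ) else 0) = (occ a α : ℂ) := by simp [occ]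
  rw [h1, ← Finset.sum_smul, h2, flipState_eq_prodState, Sm, site_mulVec_prodState]
  rcases hk : occ a α with _ | k
  · rw [sm_mulVec_flipped_zero, Nat.cast_zero, zero_smul]
    -- The scalar 0 expresses that a product state with a zero factor vanishes.
    simpa using prodState_update_smul α (fun β => flipped (occ a β)) 0 0
  · rw [sm_mulVec_flipped_succ k (by omega), prodState_update_smul]
    push_cast
    rfl

theorem Sm_mulVec_ket_zero (α : Fin N) (ψ : (Fin 0 → Fin N) → ℂ) : Sm α *ᵥ ket ψ = 0 := by
  simp only [ket, Matrix.mulVec_sum, Matrix.mulVec_smul]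
  refine Finset.sum_eq_zero fun a _ => ?_
  rw [flipState_eq_prodState, Sm, site_mulVec_prodState]
  have : occ a α = 0 := by simp [occ]
  rw [this, sm_mulVec_flipped_zero]
  have h := prodState_update_smul α (fun β => flipped (occ a β)) 0 0
  rw [zero_smul, zero_smul] at h
  rw [h, smul_zero]

/-- S⁻_α removes in turn each coordinate sitting at α; by symmetry all M+1 positions contribute
equally. Configurations with three coordinates at α, for which S⁻ is not a derivative, carry
amplitude zero. -/
theorem Sm_mulVec_ket {M : ℕ} {ψ : (Fin (M + 1) → Fin N) → ℂ} (h : IsAdmissible ψ) (α : Fin N) :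
    Sm α *ᵥ ket ψ = ((M : ℂ) + 1) • ket fun b => ψ (Fin.cons α b) := by
  have h1 : ∀ a, ψ a • (Sm α *ᵥ flipState a) =
      ∑ i, if a i = α then ψ a • flipState (fun j => a (i.succAbove j)) else 0 := by
    intro a
    by_cases ha : occ a α ≤ 2
    · rw [Sm_mulVec_flipState α a ha, Finset.smul_sum]
      simp only [smul_ite, smul_zero]
    · rw [h.triple a α (by omega)]
      simp
  simp only [ket, Matrix.mulVec_sum, Matrix.mulVec_smul, h1]
  rw [Finset.sum_comm]
  have h2 : ∀ i : Fin (M + 1),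
      (∑ a : Fin (M + 1) → Fin N,
        if a i = α then ψ a • flipState (fun j => a (i.succAbove j)) else 0) =
      ∑ b : Fin M → Fin N, ψ (Fin.cons α b) • flipState b := by
    intro i
    rw [← (Fin.insertNthEquiv (fun _ => Fin N) i).sum_comp, Fintype.sum_prod_type]
    rw [Finset.sum_eq_single α]
    · refine Finset.sum_congr rfl fun b _ => ?_
      have : ψ (i.insertNth α b) = ψ (Fin.cons α b) := by
        -- A cycle moves the coordinate inserted at position i to the front without changing the
        -- order of the others.
        rw [← h.symm (Fin.cycleRange i).symm, ← Fin.insertNth_zero']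
        congr 1
        ext1 j
        refine Fin.cases ?_ (fun k => ?_) j <;> simp
      change (if (i.insertNth α b : Fin (M + 1) → Fin N) i = α then _ else 0) = _
      simp only [Fin.insertNth_apply_same, if_true]
      change ψ (i.insertNth α b) • flipState (fun j => (i.insertNth α b : Fin (M + 1) → Fin N) _) = _
      rw [this]
      simp only [Fin.insertNth_apply_succAbove]
    · intro β _ hβ
      simp [hβ]
    · simp
  rw [Finset.sum_congr rfl fun i _ => h2 i, Finset.sum_const, Finset.card_univ, Fintype.card_fin,
    ← Nat.cast_succ, Nat.cast_smul_eq_nsmul]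

/-- Lowering at the site `a 0` strips the first coordinate and keeps the state zero; after all
coordinates are stripped, the amplitude `ψ a` is the coefficient of the vacuum. -/
theorem IsAdmissible.eq_zero_of_ket_eq_zero {M : ℕ} {ψ : (Fin M → Fin N) → ℂ}
    (h : IsAdmissible ψ) (h0 : ket ψ = 0) (a : Fin M → Fin N) : ψ a = 0 := by
  induction M with
  | zero =>
    have h1 := congrFun h0 (fun _ => 2)
    simp only [ket, Finset.sum_apply, Pi.smul_apply, Pi.zero_apply, smul_eq_mul,
      Finset.univ_unique, Finset.sum_singleton] at h1
    rw [flipState_eq_prodState] at h1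
    simpa [prodState, occ, flipped_zero, Subsingleton.elim default a] using h1
  | succ M ih =>
    rw [← Fin.cons_self_tail a]
    refine ih (h.cons (a 0)) ?_ (Fin.tail a)
    have h1 := Sm_mulVec_ket h (a 0)
    rw [h0, Matrix.mulVec_zero] at h1
    exact (smul_eq_zero.mp h1.symm).resolve_left (Nat.cast_add_one_ne_zero M)

theorem Sz_mulVec_flipState {M : ℕ} (α : Fin N) (a : Fin M → Fin N) :
    Sz α *ᵥ flipState a = ((occ a α : ℂ) - 1) • flipState a := by
  rw [flipState_eq_prodState, Sz, site_mulVec_prodState, sz_mulVec_flipped,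
    prodState_update_smul]
  congr 2
  exact Function.update_eq_self α fun β => flipped (occ a β)

theorem sum_occ {M : ℕ} (a : Fin M → Fin N) : ∑ α, occ a α = M := by
  simp only [occ]
  rw [Finset.sum_comm]
  simp

/-- There are as many flips as sites, and each site contributes its occupation minus one. -/
theorem sum_Sz_mulVec_ket (ψ : (Fin N → Fin N) → ℂ) : (∑ α, Sz α) *ᵥ ket ψ = 0 := by
  simp only [ket, Matrix.mulVec_sum, Matrix.mulVec_smul, Matrix.sum_mulVec, Sz_mulVec_flipState]
  refine Finset.sum_eq_zero fun a _ => ?_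
  rw [← Finset.sum_smul, Finset.sum_sub_distrib, ← Nat.cast_sum, sum_occ]
  simp

end Ket

/-! ### The wave function as a polynomial -/

section WavePoly

variable {n : ℕ}

theorem pfaffianVandermonde_comp_perm (z : Fin (2 * n) → ℂ) (τ : Equiv.Perm (Fin (2 * n))) :
    pfaffianVandermonde (fun i => z (τ i)) = pfaffianVandermonde z := by
  unfold pfaffianVandermonde
  congr 1
  exact Equiv.sum_comp (Equiv.mulLeft τ) fun σ : Equiv.Perm (Fin (2 * n)) =>
    ∏ i : Fin (2 * n), ∏ j ∈ Finset.Ioi i with (i : ℕ) / 2 ≠ (Fin.val j) / 2, (z (σ i) - z (σ j))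

theorem waveFunction_comp_perm (z : Fin (2 * n) → ℂ) (τ : Equiv.Perm (Fin (2 * n))) :
    waveFunction (fun i => z (τ i)) = waveFunction z := by
  unfold waveFunction
  rw [pfaffianVandermonde_comp_perm, Equiv.prod_comp τ z]

theorem prod_pairs_eq_zero {y : Fin (2 * n) → ℂ} {p q : Fin (2 * n)}
    (hpq : (p : ℕ) / 2 ≠ (q : ℕ) / 2) (hy : y p = y q) :
    ∏ i : Fin (2 * n), ∏ j ∈ Finset.Ioi i with (i : ℕ) / 2 ≠ (Fin.val j) / 2, (y i - y j) = 0 := by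
  wlog hlt : p < q generalizing p q
  · refine this hpq.symm hy.symm (lt_of_le_of_ne (not_lt.mp hlt) ?_)
    rintro rfl
    exact hpq rfl
  refine Finset.prod_eq_zero (Finset.mem_univ p) (Finset.prod_eq_zero (i := q) ?_ ?_)
  · simp [hlt, hpq]
  · rw [hy, sub_self]

/-- In every term of the Pfaffian, three positions cannot all lie in one pair, so a difference of
two equal coordinates survives the cancellation. -/
theorem waveFunction_eq_zero {z : Fin (2 * n) → ℂ} {i j k : Fin (2 * n)} (hij : i ≠ j)
    (hik : i ≠ k) (hjk : j ≠ k) (h1 : z i = z j) (h2 : z i = z k) : waveFunction z = 0 := by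
  unfold waveFunction pfaffianVandermonde
  rw [Finset.sum_eq_zero, mul_zero, zero_mul]
  intro σ _
  have e1 : σ.symm i ≠ σ.symm j := σ.symm.injective.ne hij
  have e2 : σ.symm i ≠ σ.symm k := σ.symm.injective.ne hik
  have e3 : σ.symm j ≠ σ.symm k := σ.symm.injective.ne hjk
  have key : (σ.symm i : ℕ) / 2 ≠ (σ.symm j : ℕ) / 2 ∨
      (σ.symm i : ℕ) / 2 ≠ (σ.symm k : ℕ) / 2 := by
    rw [Ne, Fin.ext_iff] at e1 e2 e3
    omega
  rcases key with h | h
  · exact prod_pairs_eq_zero (y := fun i => z (σ i)) h (by simpa using h1)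
  · exact prod_pairs_eq_zero (y := fun i => z (σ i)) h (by simpa using h2)

/-- The pair of positions that `i` belongs to. -/
def block (i : Fin (2 * n)) : Fin n := ⟨(i : ℕ) / 2, by omega⟩

theorem prod_block (G : Fin n → ℂ) : ∏ i : Fin (2 * n), G (block i) = (∏ k, G k) ^ 2 := by
  rw [← Finset.prod_fiberwise' Finset.univ block, ← Finset.prod_pow]
  refine Finset.prod_congr rfl fun k _ => ?_
  rw [Finset.prod_const]
  congr 1
  rw [Finset.card_eq_two]
  refine ⟨⟨2 * k, by omega⟩, ⟨2 * k + 1, by omega⟩, by simp [Fin.ext_iff], ?_⟩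
  ext i
  simp only [Finset.mem_filter, Finset.mem_univ, true_and, block, Fin.ext_iff, Finset.mem_insert,
    Finset.mem_singleton]
  omega

theorem vandermondeProd_eq_prod_ite (y : Fin n → ℂ) :
    vandermondeProd y = ∏ k, ∏ l, if k < l then y k - y l else 1 := by
  unfold vandermondeProd
  refine Finset.prod_congr rfl fun k _ => ?_
  rw [Finset.prod_ite, Finset.prod_const_one, mul_one]
  congr 1
  ext l
  simp

/-- Two distinct blocks are joined by 2 · 2 equal factors, whence the fourth power. -/
theorem prod_pairs_block (y : Fin n → ℂ) :
    ∏ i : Fin (2 * n), ∏ j ∈ Finset.Ioi i with (i : ℕ) / 2 ≠ (Fin.val j) / 2,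
      (y (block i) - y (block j)) = vandermondeProd y ^ 4 := by
  have h : ∀ i : Fin (2 * n), ∏ j ∈ Finset.Ioi i with (i : ℕ) / 2 ≠ (Fin.val j) / 2,
      (y (block i) - y (block j)) =
      ∏ j : Fin (2 * n), if block i < block j then y (block i) - y (block j) else 1 := by
    intro i
    rw [Finset.prod_ite, Finset.prod_const_one, mul_one]
    congr 1
    ext j
    simp only [Finset.mem_filter, Finset.mem_univ, true_and, Finset.mem_Ioi, block, Fin.lt_def]
    omega
  simp only [h]
  rw [vandermondeProd_eq_prod_ite]
  simp only [fun i : Fin (2 * n) =>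
    prod_block (fun l => if block i < l then y (block i) - y l else 1)]
  rw [prod_block (fun k => (∏ l, if k < l then y k - y l else 1) ^ 2), Finset.prod_pow]
  ring

/-- If σ puts the two copies of some point into different pairs, a factor vanishes. Otherwise σ only
permutes the blocks, and the sign of that permutation disappears in the fourth power. -/
theorem prod_pairs_perm (x : Fin n → ℂ) (σ : Equiv.Perm (Fin (2 * n))) :
    (∏ i : Fin (2 * n), ∏ j ∈ Finset.Ioi i with (i : ℕ) / 2 ≠ (Fin.val j) / 2,
      (x (block (σ i)) - x (block (σ j))) = 0) ∨
    (∏ i : Fin (2 * n), ∏ j ∈ Finset.Ioi i with (i : ℕ) / 2 ≠ (Fin.val j) / 2,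
      (x (block (σ i)) - x (block (σ j))) = vandermondeProd x ^ 4) := by
  by_cases hσ : ∃ p q : Fin (2 * n), (p : ℕ) / 2 ≠ (q : ℕ) / 2 ∧ block (σ p) = block (σ q)
  · obtain ⟨p, q, h1, h2⟩ := hσ
    exact Or.inl (prod_pairs_eq_zero (y := fun i => x (block (σ i))) h1 (by simp only [h2]))
  · push Not at hσ
    right
    have hinj : Function.Injective fun k : Fin n => block (σ ⟨2 * k, by omega⟩) := by
      intro k l hkl
      by_contra hne
      refine hσ ⟨2 * k, by omega⟩ ⟨2 * l, by omega⟩ ?_ hkl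
      rw [Fin.ext_iff] at hne
      simp only
      omega
    let τ : Equiv.Perm (Fin n) := Equiv.ofBijective _ (Finite.injective_iff_bijective.mp hinj)
    have hτ : ∀ i, block (σ i) = τ (block i) := by
      intro i
      obtain ⟨m, hm⟩ := τ.surjective (block (σ i))
      rw [← hm]
      congr 1
      by_contra hne
      refine hσ i ⟨2 * m, by omega⟩ ?_ hm.symm
      rw [Fin.ext_iff] at hne
      simp only [block] at hne ⊢
      omega
    simp only [hτ]
    rw [prod_pairs_block (fun k => x (τ k)), vandermondeProd_perm, mul_pow]
    have : (((Equiv.Perm.sign τ : ℤ) : ℂ)) ^ 4 = 1 := by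
      rcases Int.units_eq_one_or (Equiv.Perm.sign τ) with h | h <;> simp [h]
      norm_num
    rw [this, one_mul]

theorem waveFunction_block_ne_zero (x : Fin n → ℂ) (hx : Function.Injective x)
    (hx0 : ∀ k, x k ≠ 0) : waveFunction (fun i => x (block i)) ≠ 0 := by
  have hV : vandermondeProd x ^ 4 ≠ 0 := by
    refine pow_ne_zero _ (Finset.prod_ne_zero_iff.mpr fun i _ =>
      Finset.prod_ne_zero_iff.mpr fun j hj => sub_ne_zero.mpr fun h => ?_)
    exact (Finset.mem_Ioi.mp hj).ne (hx h)
  refine mul_ne_zero (mul_ne_zero ?_ ?_) (Finset.prod_ne_zero_iff.mpr fun i _ => hx0 _)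
  · have : (n.factorial : ℂ) ≠ 0 := Nat.cast_ne_zero.mpr n.factorial_ne_zero
    exact one_div_ne_zero (mul_ne_zero (pow_ne_zero _ two_ne_zero) this)
  -- Every term is a natural multiple of the same number, so nothing cancels against the nonzero
  -- term of the identity.
  · choose e he using fun σ : Equiv.Perm (Fin (2 * n)) =>
      show ∃ e : ℕ, ∏ i : Fin (2 * n), ∏ j ∈ Finset.Ioi i with (i : ℕ) / 2 ≠ (Fin.val j) / 2,
          (x (block (σ i)) - x (block (σ j))) = e * vandermondeProd x ^ 4 from by
        rcases prod_pairs_perm x σ with h | h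
        · exact ⟨0, by rw [h]; simp⟩
        · exact ⟨1, by rw [h]; simp⟩
    simp only [he]
    rw [← Finset.sum_mul, ← Nat.cast_sum]
    refine mul_ne_zero (Nat.cast_ne_zero.mpr fun h0 => ?_) hV
    have h1 := Finset.sum_eq_zero_iff.mp h0 1 (Finset.mem_univ _)
    have h2 := he 1
    simp only [Equiv.Perm.one_apply] at h2
    rw [h1, prod_pairs_block, Nat.cast_zero, zero_mul] at h2
    exact hV h2

open MvPolynomial in
/-- `pfaffianVandermonde` as a polynomial. -/
noncomputable def pfaffianPoly (n : ℕ) : MvPolynomial (Fin (2 * n)) ℂ :=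
  C (1 / (2 ^ n * (n.factorial : ℂ))) * ∑ σ : Equiv.Perm (Fin (2 * n)),
    ∏ i : Fin (2 * n), ∏ j ∈ Finset.Ioi i with (i : ℕ) / 2 ≠ (Fin.val j) / 2,
      (X (σ i) - X (σ j))

/-- `waveFunction` as a polynomial. -/
noncomputable def wavePoly (n : ℕ) : MvPolynomial (Fin (2 * n)) ℂ :=
  pfaffianPoly n * ∏ i, MvPolynomial.X i

theorem eval_wavePoly (z : Fin (2 * n) → ℂ) :
    MvPolynomial.eval z (wavePoly n) = waveFunction z := by
  simp [wavePoly, pfaffianPoly, waveFunction, pfaffianVandermonde, map_sum, map_prod]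

theorem rename_wavePoly (τ : Equiv.Perm (Fin (2 * n))) :
    MvPolynomial.rename τ (wavePoly n) = wavePoly n := by
  refine MvPolynomial.funext fun z => ?_
  rw [MvPolynomial.eval_rename, eval_wavePoly, eval_wavePoly]
  exact waveFunction_comp_perm z τ

/-- In each term a variable meets, linearly, every other variable except its partner in the pairing.
-/
theorem degreeOf_pfaffianPoly_le (i : Fin (2 * n)) :
    MvPolynomial.degreeOf i (pfaffianPoly n) ≤ 2 * n - 2 := by
  classical
  refine (MvPolynomial.degreeOf_C_mul_le _ _ _).trans
    ((MvPolynomial.degreeOf_sum_le _ _ _).trans (Finset.sup_le fun σ _ => ?_))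
  set p := σ.symm i with hp
  have h1 : ∀ a b : Fin (2 * n),
      MvPolynomial.degreeOf i (MvPolynomial.X (σ a) - MvPolynomial.X (σ b) :
        MvPolynomial (Fin (2 * n)) ℂ) ≤ (if a = p then 1 else 0) + if b = p then 1 else 0 := by
    intro a b
    refine (MvPolynomial.degreeOf_sub_le _ _ _).trans ?_
    rw [MvPolynomial.degreeOf_X, MvPolynomial.degreeOf_X]
    have ha : i = σ a ↔ a = p := by rw [hp, Equiv.eq_symm_apply, eq_comm]
    have hb : i = σ b ↔ b = p := by rw [hp, Equiv.eq_symm_apply, eq_comm]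
    simp only [ha, hb]
    exact max_le (Nat.le_add_right _ _) (Nat.le_add_left _ _)
  calc _ ≤ ∑ a : Fin (2 * n), ∑ b ∈ Finset.Ioi a with (a : ℕ) / 2 ≠ (Fin.val b) / 2,
          ((if a = p then 1 else 0) + if b = p then 1 else 0) :=
        (MvPolynomial.degreeOf_prod_le _ _ _).trans (Finset.sum_le_sum fun a _ =>
          (MvPolynomial.degreeOf_prod_le _ _ _).trans (Finset.sum_le_sum fun b _ => h1 a b))
    _ = (Finset.univ.filter fun b : Fin (2 * n) => p < b ∧ (p : ℕ) / 2 ≠ (b : ℕ) / 2).card +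
        (Finset.univ.filter fun a : Fin (2 * n) => a < p ∧ (a : ℕ) / 2 ≠ (p : ℕ) / 2).card := by
        simp only [Finset.sum_add_distrib]
        congr 1
        · rw [Finset.sum_eq_single p]
          · simp only [if_true, Finset.sum_const, smul_eq_mul, mul_one]
            congr 1
            ext b
            simp
          · intro a _ ha
            simp [ha]
          · simp
        · rw [Finset.card_filter]
          refine Finset.sum_congr rfl fun a _ => ?_
          rw [Finset.sum_ite_eq']
          simp
    _ ≤ (Finset.univ.filter fun b : Fin (2 * n) => ¬ (b : ℕ) / 2 = (p : ℕ) / 2).card := by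
        rw [← Finset.card_union_of_disjoint]
        · refine Finset.card_le_card fun b => ?_
          simp only [Finset.mem_union, Finset.mem_filter, Finset.mem_univ, true_and]
          omega
        · rw [Finset.disjoint_filter]
          intro b _ h2 h3
          exact lt_asymm h2.1 h3.1
    _ ≤ 2 * n - 2 := by
        have h2 := Finset.card_filter_add_card_filter_not (s := Finset.univ)
          (fun b : Fin (2 * n) => (b : ℕ) / 2 = (p : ℕ) / 2)
        rw [Finset.card_univ, Fintype.card_fin] at h2
        have h3 : ({⟨2 * ((p : ℕ) / 2), by omega⟩, ⟨2 * ((p : ℕ) / 2) + 1, by omega⟩} :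
            Finset (Fin (2 * n))) ⊆
            Finset.univ.filter fun b : Fin (2 * n) => (b : ℕ) / 2 = (p : ℕ) / 2 := by
          intro b
          simp only [Finset.mem_insert, Finset.mem_singleton, Finset.mem_filter, Finset.mem_univ,
            true_and, Fin.ext_iff]
          omega
        have h4 := Finset.card_le_card h3
        rw [Finset.card_pair (by simp [Fin.ext_iff])] at h4
        omega

theorem wavePoly_exponent {d : Fin (2 * n) →₀ ℕ} (hd : d ∈ (wavePoly n).support)
    (i : Fin (2 * n)) : 1 ≤ d i ∧ d i + 1 ≤ 2 * n := by
  have hX : (∏ i, MvPolynomial.X i : MvPolynomial (Fin (2 * n)) ℂ) =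
      MvPolynomial.monomial (∑ i, Finsupp.single i 1) 1 := by
    simp only [MvPolynomial.X]
    rw [MvPolynomial.monomial_sum_one]
  have hone : (∑ i, Finsupp.single i 1 : Fin (2 * n) →₀ ℕ) i = 1 := by
    simp [Finsupp.finsetSum_apply, Finsupp.single_apply]
  rw [MvPolynomial.mem_support_iff, wavePoly, hX, MvPolynomial.coeff_mul_monomial'] at hd
  split_ifs at hd with hle
  · have h1 := hle i
    rw [hone] at h1
    have h2 := MvPolynomial.degreeOf_le_iff.mp (degreeOf_pfaffianPoly_le i) _
      (MvPolynomial.mem_support_iff.mpr (left_ne_zero_of_mul hd))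
    rw [Finsupp.tsub_apply, hone] at h2
    -- The existence of an index forces 2n ≥ 2, so the truncated subtraction in 2n - 2 is harmless.
    have := i.2
    omega
  · exact absurd rfl hd

end WavePoly

/-! ### Sums over the lattice -/

section Lattice

variable {N : ℕ}

theorem eta_eq_pow (α : Fin N) : eta N α = Complex.exp (2 * Real.pi * Complex.I / N) ^ (α : ℕ) := by
  rw [eta, ← Complex.exp_nat_mul]
  congr 1
  ring

theorem eta_ne_zero (α : Fin N) : eta N α ≠ 0 := Complex.exp_ne_zero _

theorem eta_pow_card (α : Fin N) : eta N α ^ N = 1 := by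
  have hN : N ≠ 0 := (Nat.zero_le _).trans_lt α.2 |>.ne'
  rw [eta_eq_pow, pow_right_comm, (Complex.isPrimitiveRoot_exp N hN).pow_eq_one, one_pow]

theorem eta_injective : Function.Injective (eta N) := by
  intro α β h
  have hN : N ≠ 0 := (Nat.zero_le _).trans_lt α.2 |>.ne'
  rw [eta_eq_pow, eta_eq_pow] at h
  exact Fin.ext ((Complex.isPrimitiveRoot_exp N hN).pow_inj α.2 β.2 h)

theorem conj_eta (α : Fin N) : conj (eta N α) = (eta N α)⁻¹ := by
  rw [eta, ← Complex.exp_conj, ← Complex.exp_neg]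
  congr 1
  simp [Complex.conj_ofReal, neg_div, map_ofNat]

theorem sum_eta_pow {k : ℕ} (hk : 0 < k) (hkN : k < N) : ∑ β, eta N β ^ k = 0 := by
  have hN : N ≠ 0 := by omega
  have hζ := Complex.isPrimitiveRoot_exp N hN
  simp only [eta_eq_pow, ← pow_mul]
  rw [Fin.sum_univ_eq_sum_range fun i => Complex.exp (2 * Real.pi * Complex.I / N) ^ (i * k)]
  simp only [mul_comm _ k, pow_mul]
  have h1 : Complex.exp (2 * Real.pi * Complex.I / N) ^ k ≠ 1 :=
    hζ.pow_ne_one_of_pos_of_lt hk.ne' hkN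
  have h2 := mul_geom_sum (Complex.exp (2 * Real.pi * Complex.I / N) ^ k) N
  rw [← pow_mul, mul_comm k N, pow_mul, hζ.pow_eq_one, one_pow, sub_self] at h2
  exact (mul_eq_zero.mp h2).resolve_left (sub_ne_zero.mpr h1)

theorem eta_sub_ne_zero {α β : Fin N} (h : β ≠ α) : eta N α - eta N β ≠ 0 :=
  sub_ne_zero.mpr fun e => h (eta_injective e).symm

theorem sum_range_cast (N : ℕ) : ∑ k ∈ Finset.range N, (k : ℂ) = N * (N - 1) / 2 := by
  induction N with
  | zero => simp
  | succ N ih => rw [Finset.sum_range_succ, ih]; push_cast; ring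

theorem sum_range_cast_sq (N : ℕ) :
    ∑ k ∈ Finset.range N, (k : ℂ) ^ 2 = N * (N - 1) * (2 * N - 1) / 6 := by
  induction N with
  | zero => simp
  | succ N ih => rw [Finset.sum_range_succ, ih]; push_cast; ring

/-- The ratio of two lattice sites. -/
noncomputable def ratio (α β : Fin N) : ℂ := eta N β / eta N α

theorem ratio_ne_one {α β : Fin N} (h : β ≠ α) : 1 - ratio α β ≠ 0 := by
  rw [ratio, one_sub_div (eta_ne_zero α)]
  exact div_ne_zero (eta_sub_ne_zero h) (eta_ne_zero α)

theorem sum_ratio_pow (α : Fin N) {k : ℕ} (hk : 0 < k) (hkN : k < N) :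
    ∑ β ∈ Finset.univ.erase α, ratio α β ^ k = -1 := by
  have h := Finset.add_sum_erase Finset.univ (fun β => ratio α β ^ k) (Finset.mem_univ α)
  have h2 : ∑ β, ratio α β ^ k = 0 := by
    simp only [ratio, div_pow, ← Finset.sum_div, sum_eta_pow hk hkN, zero_div]
  have h3 : ratio α α = 1 := div_self (eta_ne_zero α)
  rw [h2, h3, one_pow] at h
  linear_combination h

theorem sum_range_ratio_pow {α β : Fin N} (h : β ≠ α) :
    ∑ k ∈ Finset.range N, ratio α β ^ (k + 1) = 0 := by
  have h2 := mul_geom_sum (ratio α β) N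
  have h3 : ratio α β ^ N = 1 := by rw [ratio, div_pow, eta_pow_card, eta_pow_card, div_one]
  rw [h3, sub_self] at h2
  have h4 : ratio α β - 1 ≠ 0 := by
    rw [← neg_sub]
    exact neg_ne_zero.mpr (ratio_ne_one h)
  simp only [pow_succ]
  rw [← Finset.sum_mul, (mul_eq_zero.mp h2).resolve_left h4, zero_mul]

/-- Consecutive sums differ by a sum of powers, equal to -1, which determines them up to the initial
value. That value follows because the total over a full period of exponents is zero. -/
theorem sum_ratio_div (α : Fin N) {k : ℕ} (hk : k < N) :
    ∑ β ∈ Finset.univ.erase α, ratio α β ^ (k + 1) / (1 - ratio α β) =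
      (k : ℂ) + 1 - (N + 1) / 2 := by
  have hN : (N : ℂ) ≠ 0 := Nat.cast_ne_zero.mpr (by omega)
  set f : ℕ → ℂ := fun k => ∑ β ∈ Finset.univ.erase α, ratio α β ^ (k + 1) / (1 - ratio α β)
    with hf
  have hrec : ∀ k, k < N → f k = f 0 + k := by
    intro k
    induction k with
    | zero => simp
    | succ k ih =>
      intro hk
      have h1 : f k - f (k + 1) = -1 := by
        rw [← sum_ratio_pow α (Nat.succ_pos k) hk, hf, ← Finset.sum_sub_distrib]
        refine Finset.sum_congr rfl fun β hβ => ?_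
        have := ratio_ne_one (Finset.ne_of_mem_erase hβ)
        field_simp
        ring
      have := ih (by omega)
      push_cast
      linear_combination this - h1
  have htot : ∑ k ∈ Finset.range N, f k = 0 := by
    rw [hf, Finset.sum_comm]
    refine Finset.sum_eq_zero fun β hβ => ?_
    rw [← Finset.sum_div, sum_range_ratio_pow (Finset.ne_of_mem_erase hβ), zero_div]
  rw [Finset.sum_congr rfl fun k hk => hrec k (Finset.mem_range.mp hk), Finset.sum_add_distrib,
    sum_range_cast, Finset.sum_const, Finset.card_range, nsmul_eq_mul] at htot
  have h0 : f 0 = -(N - 1) / 2 := mul_left_cancel₀ hN (by linear_combination htot)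
  change f k = _
  rw [hrec k hk, h0]
  ring

/-- Same method, one order higher: the differences are now the sums in `sum_ratio_div`. -/
theorem sum_ratio_div_sq (α : Fin N) {k : ℕ} (hk : k ≤ N) :
    ∑ β ∈ Finset.univ.erase α, ratio α β ^ (k + 1) / (1 - ratio α β) ^ 2 =
      -((N : ℂ) ^ 2 - 1) / 12 - k * (k - N) / 2 := by
  have hN : (N : ℂ) ≠ 0 := Nat.cast_ne_zero.mpr ((Nat.zero_le _).trans_lt α.2).ne'
  set f : ℕ → ℂ := fun k => ∑ β ∈ Finset.univ.erase α, ratio α β ^ (k + 1) / (1 - ratio α β) ^ 2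
    with hf
  have hrec : ∀ k, k ≤ N → f k = f 0 - k * (k - N) / 2 := by
    intro k
    induction k with
    | zero => simp
    | succ k ih =>
      intro hk
      have h1 : f k - f (k + 1) = (k : ℂ) + 1 - (N + 1) / 2 := by
        rw [← sum_ratio_div α (Nat.lt_of_succ_le hk), hf, ← Finset.sum_sub_distrib]
        refine Finset.sum_congr rfl fun β hβ => ?_
        have := ratio_ne_one (Finset.ne_of_mem_erase hβ)
        field_simp
        ring
      have := ih (by omega)
      push_cast
      linear_combination this - h1
  have htot : ∑ k ∈ Finset.range N, f k = 0 := by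
    rw [hf, Finset.sum_comm]
    refine Finset.sum_eq_zero fun β hβ => ?_
    rw [← Finset.sum_div, sum_range_ratio_pow (Finset.ne_of_mem_erase hβ), zero_div]
  have hsum : ∑ k ∈ Finset.range N, f k = ∑ k ∈ Finset.range N,
      (f 0 + (N / 2) * (k : ℂ) - (1 / 2) * (k : ℂ) ^ 2) :=
    Finset.sum_congr rfl fun k hk => by rw [hrec k (Finset.mem_range.mp hk).le]; ring
  rw [hsum, Finset.sum_sub_distrib, Finset.sum_add_distrib, ← Finset.mul_sum, ← Finset.mul_sum,
    sum_range_cast, sum_range_cast_sq, Finset.sum_const, Finset.card_range, nsmul_eq_mul] at htot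
  have h0 : f 0 = -((N : ℂ) ^ 2 - 1) / 12 := mul_left_cancel₀ hN (by linear_combination htot)
  change f k = _
  rw [hrec k hk, h0]

theorem sum_eta_pow_div (α : Fin N) {k : ℕ} (hk : 1 ≤ k) (hkN : k ≤ N) :
    ∑ β ∈ Finset.univ.erase α, 1 / (eta N α - eta N β) * eta N β ^ k =
      (eta N α)⁻¹ * (((k : ℂ) - (N + 1) / 2) * eta N α ^ k) := by
  obtain ⟨k, rfl⟩ := Nat.exists_eq_add_of_le' hk
  have h := sum_ratio_div α (k := k) (by omega)
  push_cast
  rw [← h, Finset.sum_mul, Finset.mul_sum]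
  refine Finset.sum_congr rfl fun β hβ => ?_
  have h1 := eta_sub_ne_zero (Finset.ne_of_mem_erase hβ)
  have h2 := eta_ne_zero α
  rw [ratio, one_sub_div h2, div_pow]
  field_simp

/-- The range up to N+1 is needed for the conjugate weights, which raise an exponent of at most N-1
by two. -/
theorem sum_eta_pow_div_sq (α : Fin N) {k : ℕ} (hk : 1 ≤ k) (hkN : k ≤ N + 1) :
    ∑ β ∈ Finset.univ.erase α, 1 / (eta N α - eta N β) ^ 2 * eta N β ^ k =
      (eta N α)⁻¹ ^ 2 * ((-((N : ℂ) ^ 2 - 1) / 12 - (k - 1) * (k - 1 - N) / 2) * eta N α ^ k) := by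
  obtain ⟨k, rfl⟩ := Nat.exists_eq_add_of_le' hk
  have h := sum_ratio_div_sq α (k := k) (by omega)
  push_cast
  rw [add_sub_cancel_right, ← h, Finset.sum_mul, Finset.mul_sum]
  refine Finset.sum_congr rfl fun β hβ => ?_
  have h1 := eta_sub_ne_zero (Finset.ne_of_mem_erase hβ)
  have h2 := eta_ne_zero α
  rw [ratio, one_sub_div h2, div_pow]
  field_simp

/-- Conjugation is inversion on the unit circle, so conjugate weights are the original ones with the
exponent of η_β raised by one. For β = α both sides are zero, since division by zero gives zero. -/
theorem one_div_conj_sub (α β : Fin N) :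
    1 / (conj (eta N α) - conj (eta N β)) =
      -(eta N α) * (1 / (eta N α - eta N β) * eta N β) := by
  have h1 := eta_ne_zero α
  have h2 := eta_ne_zero β
  rcases eq_or_ne β α with rfl | h
  · simp
  · have h3 := eta_sub_ne_zero h
    have h4 : conj (eta N α) - conj (eta N β) =
        -(eta N α - eta N β) / (eta N α * eta N β) := by
      rw [conj_eta, conj_eta]
      field_simp
      ring
    rw [h4]
    field_simp

end Lattice

/-! ### Moments of symmetric polynomials -/

section Moments

/-- Symmetric polynomials with all exponents between `1` and `N - 1` that vanish if three
coordinates coincide. -/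
structure IsLatticePoly (N : ℕ) {M : ℕ} (P : MvPolynomial (Fin M) ℂ) : Prop where
  symm : ∀ τ : Equiv.Perm (Fin M), MvPolynomial.rename τ P = P
  exponent : ∀ d ∈ P.support, ∀ i, 1 ≤ d i ∧ d i + 1 ≤ N
  triple : ∀ (z : Fin M → ℂ) (i j k : Fin M), i ≠ j → i ≠ k → j ≠ k → z i = z j → z i = z k →
    MvPolynomial.eval z P = 0

/-- A polynomial that vanishes identically has zero coefficients, and the weight is constant on the
terms that make up one coefficient. -/
theorem sum_weighted_pow_eq_zero {ι : Type*} (s : Finset ι) (a : ι → ℂ) (e : ι → ℕ)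
    (h : ∀ t : ℂ, ∑ i ∈ s, a i * t ^ e i = 0) (g : ℕ → ℂ) (x : ℂ) :
    ∑ i ∈ s, a i * g (e i) * x ^ e i = 0 := by
  classical
  have hp : ∑ i ∈ s, Polynomial.C (a i) * Polynomial.X ^ e i = 0 := by
    refine Polynomial.funext fun t => ?_
    simpa [Polynomial.eval_finsetSum] using h t
  rw [← Finset.sum_fiberwise_of_maps_to (t := s.image e) fun i hi => Finset.mem_image_of_mem e hi]
  refine Finset.sum_eq_zero fun m _ => ?_
  have hm := congrArg (fun p => Polynomial.coeff p m) hp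
  simp only [Polynomial.finsetSum_coeff, Polynomial.coeff_C_mul_X_pow, Polynomial.coeff_zero] at hm
  rw [← Finset.sum_filter] at hm
  have h1 : ∑ i ∈ s with e i = m, a i * g (e i) * x ^ e i =
      (∑ i ∈ s with m = e i, a i) * (g m * x ^ m) := by
    rw [Finset.sum_mul]
    refine Finset.sum_congr (by ext; simp [eq_comm]) fun i hi => ?_
    rw [← (Finset.mem_filter.mp hi).2]
    ring
  rw [h1, hm, zero_mul]

variable {N K : ℕ}

theorem two_mod_add_three (K : ℕ) : 2 % (K + 3) = 2 := Nat.mod_eq_of_lt (by omega)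

/-- The sum over the monomials of `P` at `(x, x, x, b)`, weighted by a function of the first three
exponents. -/
noncomputable def moment (P : MvPolynomial (Fin (K + 3)) ℂ) (x : ℂ) (b : Fin K → ℂ)
    (g : ℕ → ℕ → ℕ → ℂ) : ℂ :=
  ∑ d ∈ P.support, P.coeff d * (g (d 0) (d 1) (d 2) *
    (x ^ (d 0 + d 1 + d 2) * ∏ j : Fin K, b j ^ d j.succ.succ.succ))

theorem eval_cons_three (P : MvPolynomial (Fin (K + 3)) ℂ) (u v w : ℂ) (b : Fin K → ℂ) :
    MvPolynomial.eval (Fin.cons u (Fin.cons v (Fin.cons w b : Fin (K + 1) → ℂ) :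
      Fin (K + 2) → ℂ) : Fin (K + 3) → ℂ) P =
      ∑ d ∈ P.support, P.coeff d *
        (u ^ d 0 * (v ^ d 1 * (w ^ d 2 * ∏ j : Fin K, b j ^ d j.succ.succ.succ))) := by
  rw [MvPolynomial.eval_eq']
  refine Finset.sum_congr rfl fun d _ => ?_
  rw [Fin.prod_univ_succ, Fin.prod_univ_succ, Fin.prod_univ_succ]
  rfl

theorem moment_add (P : MvPolynomial (Fin (K + 3)) ℂ) (x : ℂ) (b : Fin K → ℂ)
    (g h : ℕ → ℕ → ℕ → ℂ) :
    moment P x b (fun k l m => g k l m + h k l m) = moment P x b g + moment P x b h := by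
  simp only [moment, add_mul, mul_add, Finset.sum_add_distrib]

theorem moment_sub (P : MvPolynomial (Fin (K + 3)) ℂ) (x : ℂ) (b : Fin K → ℂ)
    (g h : ℕ → ℕ → ℕ → ℂ) :
    moment P x b (fun k l m => g k l m - h k l m) = moment P x b g - moment P x b h := by
  simp only [moment, sub_mul, mul_sub, Finset.sum_sub_distrib]

theorem moment_mul_left (P : MvPolynomial (Fin (K + 3)) ℂ) (x : ℂ) (b : Fin K → ℂ) (c : ℂ)
    (g : ℕ → ℕ → ℕ → ℂ) : moment P x b (fun k l m => c * g k l m) = c * moment P x b g := by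
  simp only [moment, Finset.mul_sum]
  exact Finset.sum_congr rfl fun d _ => by ring

variable {P : MvPolynomial (Fin (K + 3)) ℂ}

theorem IsLatticePoly.sum_support_perm (hP : IsLatticePoly N P) (τ : Equiv.Perm (Fin (K + 3)))
    (F : (Fin (K + 3) →₀ ℕ) → ℂ → ℂ) :
    ∑ d ∈ P.support, F (Finsupp.equivMapDomain τ d) (P.coeff d) =
      ∑ d ∈ P.support, F d (P.coeff d) := by
  have hc : ∀ d, P.coeff (Finsupp.equivMapDomain τ d) = P.coeff d := by
    intro d
    rw [Finsupp.equivMapDomain_eq_mapDomain]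
    conv_lhs => rw [← hP.symm τ]
    exact MvPolynomial.coeff_rename_mapDomain τ τ.injective P d
  refine Finset.sum_equiv (Finsupp.domCongr τ).toEquiv (fun d => ?_) fun d _ => ?_
  · simp [MvPolynomial.mem_support_iff, Finsupp.domCongr_apply, hc]
  · simp [Finsupp.domCongr_apply, hc]

theorem IsLatticePoly.moment_swap_zero_one (hP : IsLatticePoly N P) (x : ℂ) (b : Fin K → ℂ)
    (g : ℕ → ℕ → ℕ → ℂ) : moment P x b (fun k l m => g l k m) = moment P x b g := by
  rw [moment, moment, ← hP.sum_support_perm (Equiv.swap 0 1) fun d c => c * (g (d 0) (d 1) (d 2) *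
    (x ^ (d 0 + d 1 + d 2) * ∏ j : Fin K, b j ^ d j.succ.succ.succ))]
  refine Finset.sum_congr rfl fun d _ => ?_
  have h2 : (Equiv.swap 0 1 : Equiv.Perm (Fin (K + 3))) 2 = 2 :=
    Equiv.swap_apply_of_ne_of_ne (by simp [Fin.ext_iff, two_mod_add_three])
      (by simp [Fin.ext_iff, two_mod_add_three])
  have h3 : ∀ j : Fin K, (Equiv.swap 0 1 : Equiv.Perm (Fin (K + 3))) j.succ.succ.succ =
      j.succ.succ.succ := fun j =>
    Equiv.swap_apply_of_ne_of_ne (by simp [Fin.ext_iff]) (by simp [Fin.ext_iff])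
  simp only [Finsupp.equivMapDomain_apply, Equiv.symm_swap, Equiv.swap_apply_left,
    Equiv.swap_apply_right, h2, h3, add_comm (d 1) (d 0)]

theorem IsLatticePoly.moment_swap_zero_two (hP : IsLatticePoly N P) (x : ℂ) (b : Fin K → ℂ)
    (g : ℕ → ℕ → ℕ → ℂ) : moment P x b (fun k l m => g m l k) = moment P x b g := by
  rw [moment, moment, ← hP.sum_support_perm (Equiv.swap 0 2) fun d c => c * (g (d 0) (d 1) (d 2) *
    (x ^ (d 0 + d 1 + d 2) * ∏ j : Fin K, b j ^ d j.succ.succ.succ))]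
  refine Finset.sum_congr rfl fun d _ => ?_
  have h2 : (Equiv.swap 0 2 : Equiv.Perm (Fin (K + 3))) 1 = 1 :=
    Equiv.swap_apply_of_ne_of_ne (by simp) (by simp [Fin.ext_iff, two_mod_add_three])
  have h3 : ∀ j : Fin K, (Equiv.swap 0 2 : Equiv.Perm (Fin (K + 3))) j.succ.succ.succ =
      j.succ.succ.succ := fun j =>
    Equiv.swap_apply_of_ne_of_ne (by simp [Fin.ext_iff]) (by simp [Fin.ext_iff, two_mod_add_three])
  simp only [Finsupp.equivMapDomain_apply, Equiv.symm_swap, Equiv.swap_apply_left,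
    Equiv.swap_apply_right, h2, h3]
  rw [show d 2 + d 1 + d 0 = d 0 + d 1 + d 2 by ring]

/-- Apply `sum_weighted_pow_eq_zero` to the polynomial t ↦ P(t,t,t,b), whose exponents are the
totals k+l+m. -/
theorem IsLatticePoly.moment_total (hP : IsLatticePoly N P) (x : ℂ) (b : Fin K → ℂ) (g : ℕ → ℂ) :
    moment P x b (fun k l m => g (k + l + m)) = 0 := by
  have h := sum_weighted_pow_eq_zero P.support
    (fun d => P.coeff d * ∏ j : Fin K, b j ^ d j.succ.succ.succ) (fun d => d 0 + d 1 + d 2) ?_ g x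
  · rw [← h, moment]
    exact Finset.sum_congr rfl fun d _ => by ring
  · intro t
    have h1 := hP.triple (Fin.cons t (Fin.cons t (Fin.cons t b : Fin (K + 1) → ℂ) :
      Fin (K + 2) → ℂ) : Fin (K + 3) → ℂ) 0 1 2 (by simp) (by simp [Fin.ext_iff, two_mod_add_three])
      (by simp [Fin.ext_iff, two_mod_add_three]) rfl rfl
    rw [eval_cons_three] at h1
    rw [← h1]
    exact Finset.sum_congr rfl fun d _ => by ring

/-- By symmetry of P, the moments of k and of l are each a third of that of k+l+m, and the moment of
2kl + k² is a third of that of (k+l+m)². -/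
theorem IsLatticePoly.moment_quadratic (hP : IsLatticePoly N P) (x : ℂ) (b : Fin K → ℂ)
    (c₀ c₁ c₂ c₃ : ℂ) :
    moment P x b (fun k l _ => c₀ + (c₁ * k + (c₂ * l + c₃ * (2 * (k * l) + k ^ 2)))) = 0 := by
  have h0 : moment P x b (fun _ _ _ => 1) = 0 := hP.moment_total x b fun _ => 1
  have e1 : moment P x b (fun _ l _ => (l : ℂ)) = moment P x b (fun k _ _ => (k : ℂ)) :=
    hP.moment_swap_zero_one x b fun k _ _ => (k : ℂ)
  have e2 : moment P x b (fun _ _ m => (m : ℂ)) = moment P x b (fun k _ _ => (k : ℂ)) :=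
    hP.moment_swap_zero_two x b fun k _ _ => (k : ℂ)
  have e3 : moment P x b (fun _ l _ => (l : ℂ) ^ 2) = moment P x b (fun k _ _ => (k : ℂ) ^ 2) :=
    hP.moment_swap_zero_one x b fun k _ _ => (k : ℂ) ^ 2
  have e4 : moment P x b (fun _ _ m => (m : ℂ) ^ 2) = moment P x b (fun k _ _ => (k : ℂ) ^ 2) :=
    hP.moment_swap_zero_two x b fun k _ _ => (k : ℂ) ^ 2
  have e5 : moment P x b (fun _ l m => (m : ℂ) * l) = moment P x b (fun k l _ => (k : ℂ) * l) :=
    hP.moment_swap_zero_two x b fun k l _ => (k : ℂ) * l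
  have e6 : moment P x b (fun k _ m => (m : ℂ) * k) = moment P x b (fun _ l m => (m : ℂ) * l) :=
    hP.moment_swap_zero_one x b fun _ l m => (m : ℂ) * l
  have h1 := hP.moment_total x b fun s => (s : ℂ)
  have h2 := hP.moment_total x b fun s => (s : ℂ) ^ 2
  have s1 : (fun k l m : ℕ => ((k + l + m : ℕ) : ℂ)) = fun k l m : ℕ =>
      (k : ℂ) + ((l : ℂ) + (m : ℂ)) := by
    funext k l m; push_cast; ring
  have s2 : (fun k l m : ℕ => ((k + l + m : ℕ) : ℂ) ^ 2) = fun k l m : ℕ =>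
      (k : ℂ) ^ 2 + ((l : ℂ) ^ 2 + ((m : ℂ) ^ 2 + (2 * ((k : ℂ) * l) +
        (2 * ((m : ℂ) * l) + 2 * ((m : ℂ) * k))))) := by
    funext k l m; push_cast; ring
  have s3 : (fun _ _ _ : ℕ => c₀) = fun _ _ _ => c₀ * 1 := by simp
  rw [s1, moment_add, moment_add, e1, e2] at h1
  rw [s2, moment_add, moment_add, moment_add, moment_add, moment_add, moment_mul_left,
    moment_mul_left, moment_mul_left, e3, e4, e6, e5] at h2
  rw [moment_add, moment_add, moment_add, moment_mul_left, moment_mul_left, moment_mul_left,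
    moment_add, moment_mul_left, e1, s3, moment_mul_left, h0]
  linear_combination (c₁ + c₂) / 3 * h1 + c₃ / 3 * h2

theorem sum_mul_eval_cons_eq (c : Fin N → ℂ) (s : Finset (Fin N)) (x : ℂ) (b : Fin K → ℂ)
    (A : ℂ) (f : ℕ → ℂ)
    (h : ∀ d ∈ P.support, ∑ β ∈ s, c β * eta N β ^ d 0 = A * (f (d 0) * x ^ d 0)) :
    ∑ β ∈ s, c β * MvPolynomial.eval (Fin.cons (eta N β) (Fin.cons x (Fin.cons x b :
      Fin (K + 1) → ℂ) : Fin (K + 2) → ℂ) : Fin (K + 3) → ℂ) P =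
      A * moment P x b fun k _ _ => f k := by
  simp only [eval_cons_three, moment, Finset.mul_sum]
  rw [Finset.sum_comm]
  refine Finset.sum_congr rfl fun d hd => ?_
  have h1 := h d hd
  calc _ = (∑ β ∈ s, c β * eta N β ^ d 0) * (P.coeff d *
        (x ^ d 1 * (x ^ d 2 * ∏ j : Fin K, b j ^ d j.succ.succ.succ))) := by
        rw [Finset.sum_mul]
        exact Finset.sum_congr rfl fun β _ => by ring
    _ = _ := by rw [h1]; ring

theorem sum_sum_mul_eval_cons_eq (c : Fin N → ℂ) (s : Finset (Fin N)) (x : ℂ) (b : Fin K → ℂ)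
    (A : ℂ) (f : ℕ → ℂ)
    (h : ∀ d ∈ P.support, ∀ i, ∑ β ∈ s, c β * eta N β ^ d i = A * (f (d i) * x ^ d i)) :
    ∑ β ∈ s, ∑ γ ∈ s, c β * c γ * MvPolynomial.eval (Fin.cons (eta N γ) (Fin.cons (eta N β)
      (Fin.cons x b : Fin (K + 1) → ℂ) : Fin (K + 2) → ℂ) : Fin (K + 3) → ℂ) P =
      A ^ 2 * moment P x b fun k l _ => f k * f l := by
  simp only [eval_cons_three, moment, Finset.mul_sum]
  rw [Finset.sum_congr rfl fun β _ => Finset.sum_comm, Finset.sum_comm]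
  refine Finset.sum_congr rfl fun d hd => ?_
  calc _ = (∑ β ∈ s, c β * eta N β ^ d 1) * (∑ γ ∈ s, c γ * eta N γ ^ d 0) * (P.coeff d *
        (x ^ d 2 * ∏ j : Fin K, b j ^ d j.succ.succ.succ)) := by
        rw [Finset.sum_mul_sum, Finset.sum_mul]
        refine Finset.sum_congr rfl fun β _ => ?_
        rw [Finset.sum_mul]
        exact Finset.sum_congr rfl fun γ _ => by ring
    _ = _ := by rw [h d hd 0, h d hd 1]; ring

theorem IsLatticePoly.sum_eta_pow_div (hP : IsLatticePoly N P) (α : Fin N) :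
    ∀ d ∈ P.support, ∀ i, ∑ β ∈ Finset.univ.erase α, 1 / (eta N α - eta N β) * eta N β ^ d i =
      (eta N α)⁻¹ * (((d i : ℂ) - (N + 1) / 2) * eta N α ^ d i) := by
  intro d hd i
  have := hP.exponent d hd i
  exact PfaffianChain.sum_eta_pow_div α this.1 (by omega)

theorem IsLatticePoly.sum_eta_pow_div_conj (hP : IsLatticePoly N P) (α : Fin N) :
    ∀ d ∈ P.support, ∀ i,
      ∑ β ∈ Finset.univ.erase α, 1 / (conj (eta N α) - conj (eta N β)) * eta N β ^ d i =
      -eta N α * (((d i : ℂ) + 1 - (N + 1) / 2) * eta N α ^ d i) := by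
  intro d hd i
  have := hP.exponent d hd i
  -- The upper bound N-1 on the exponents leaves room for the shift by one.
  have h := PfaffianChain.sum_eta_pow_div α (k := d i + 1) (by omega) (by omega)
  simp only [one_div_conj_sub, mul_assoc, ← pow_succ', ← Finset.mul_sum]
  rw [h, pow_succ]
  have := eta_ne_zero α
  push_cast
  field_simp

theorem IsLatticePoly.sum_eta_pow_div_sq (hP : IsLatticePoly N P) (α : Fin N) :
    ∀ d ∈ P.support, ∑ β ∈ Finset.univ.erase α, 1 / (eta N α - eta N β) ^ 2 * eta N β ^ d 0 =
      (eta N α)⁻¹ ^ 2 * ((-((N : ℂ) ^ 2 - 1) / 12 - ((d 0 : ℂ) - 1) * ((d 0 : ℂ) - 1 - N) / 2) *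
        eta N α ^ d 0) := by
  intro d hd
  have := hP.exponent d hd 0
  exact PfaffianChain.sum_eta_pow_div_sq α this.1 (by omega)

theorem IsLatticePoly.sum_eta_pow_div_conj_sq (hP : IsLatticePoly N P) (α : Fin N) :
    ∀ d ∈ P.support,
      ∑ β ∈ Finset.univ.erase α, 1 / (conj (eta N α) - conj (eta N β)) ^ 2 * eta N β ^ d 0 =
      (-eta N α) ^ 2 * ((-((N : ℂ) ^ 2 - 1) / 12 - ((d 0 : ℂ) + 1) * ((d 0 : ℂ) + 1 - N) / 2) *
        eta N α ^ d 0) := by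
  intro d hd
  have := hP.exponent d hd 0
  have h := PfaffianChain.sum_eta_pow_div_sq α (k := d 0 + 2) (by omega) (by omega)
  calc _ = (-eta N α) ^ 2 * ∑ β ∈ Finset.univ.erase α,
        1 / (eta N α - eta N β) ^ 2 * eta N β ^ (d 0 + 2) := by
        rw [Finset.mul_sum]
        refine Finset.sum_congr rfl fun β _ => ?_
        rw [← _root_.one_div_pow, one_div_conj_sub, ← _root_.one_div_pow]
        ring
    _ = _ := by
        rw [h, pow_add]
        have := eta_ne_zero α
        push_cast
        field_simp
        ring

theorem IsLatticePoly.omega (hP : IsLatticePoly N P) (α : Fin N) (b : Fin K → ℂ) :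
    ∑ β ∈ Finset.univ.erase α, 1 / (eta N α - eta N β) *
      MvPolynomial.eval (Fin.cons (eta N β) (Fin.cons (eta N α) (Fin.cons (eta N α) b :
      Fin (K + 1) → ℂ) : Fin (K + 2) → ℂ) : Fin (K + 3) → ℂ) P = 0 := by
  rw [sum_mul_eval_cons_eq _ _ _ _ (eta N α)⁻¹ (fun k => (k : ℂ) - (N + 1) / 2)
    fun d hd => hP.sum_eta_pow_div α d hd 0]
  have h := hP.moment_quadratic (eta N α) b (-((N + 1) / 2)) 1 0 0
  rw [mul_eq_zero]
  right
  rw [← h]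
  congr 1
  funext k l m
  ring

theorem IsLatticePoly.omegaBar (hP : IsLatticePoly N P) (α : Fin N) (b : Fin K → ℂ) :
    ∑ β ∈ Finset.univ.erase α, 1 / (conj (eta N α) - conj (eta N β)) *
      MvPolynomial.eval (Fin.cons (eta N β) (Fin.cons (eta N α) (Fin.cons (eta N α) b :
      Fin (K + 1) → ℂ) : Fin (K + 2) → ℂ) : Fin (K + 3) → ℂ) P = 0 := by
  rw [sum_mul_eval_cons_eq _ _ _ _ (-eta N α) (fun k => (k : ℂ) + 1 - (N + 1) / 2)
    fun d hd => hP.sum_eta_pow_div_conj α d hd 0]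
  have h := hP.moment_quadratic (eta N α) b (1 - (N + 1) / 2) 1 0 0
  rw [mul_eq_zero]
  right
  rw [← h]
  congr 1
  funext k l m
  ring

/-- The double sum contributes kl and the subtracted single sum contributes k²/2. Together they form
half of 2kl + k², the only quadratic combination to which `moment_quadratic` applies; this explains
the second term of Ξ_α. -/
theorem IsLatticePoly.xi (hP : IsLatticePoly N P) (α : Fin N) (b : Fin K → ℂ) :
    (∑ β ∈ Finset.univ.erase α, ∑ γ ∈ Finset.univ.erase α,
      1 / (eta N α - eta N β) * (1 / (eta N α - eta N γ)) *
      MvPolynomial.eval (Fin.cons (eta N γ) (Fin.cons (eta N β) (Fin.cons (eta N α) b :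
      Fin (K + 1) → ℂ) : Fin (K + 2) → ℂ) : Fin (K + 3) → ℂ) P) -
    ∑ β ∈ Finset.univ.erase α, 1 / (eta N α - eta N β) ^ 2 *
      MvPolynomial.eval (Fin.cons (eta N β) (Fin.cons (eta N α) (Fin.cons (eta N α) b :
      Fin (K + 1) → ℂ) : Fin (K + 2) → ℂ) : Fin (K + 3) → ℂ) P = 0 := by
  rw [sum_sum_mul_eval_cons_eq _ _ _ _ (eta N α)⁻¹ (fun k => (k : ℂ) - (N + 1) / 2)
    (hP.sum_eta_pow_div α),
    sum_mul_eval_cons_eq _ _ _ _ ((eta N α)⁻¹ ^ 2) (fun k => -((N : ℂ) ^ 2 - 1) / 12 -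
      ((k : ℂ) - 1) * ((k : ℂ) - 1 - N) / 2) (hP.sum_eta_pow_div_sq α),
    ← mul_sub, ← moment_sub, mul_eq_zero]
  right
  have h := hP.moment_quadratic (eta N α) b
    (((N + 1 : ℂ) / 2) ^ 2 + (N ^ 2 - 1) / 12 + (N + 1) / 2) (-(N + 1) / 2 - (N + 2) / 2)
    (-(N + 1) / 2) (1 / 2)
  rw [← h]
  congr 1
  funext k l m
  ring

theorem IsLatticePoly.xiBar (hP : IsLatticePoly N P) (α : Fin N) (b : Fin K → ℂ) :
    (∑ β ∈ Finset.univ.erase α, ∑ γ ∈ Finset.univ.erase α,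
      1 / (conj (eta N α) - conj (eta N β)) * (1 / (conj (eta N α) - conj (eta N γ))) *
      MvPolynomial.eval (Fin.cons (eta N γ) (Fin.cons (eta N β) (Fin.cons (eta N α) b :
      Fin (K + 1) → ℂ) : Fin (K + 2) → ℂ) : Fin (K + 3) → ℂ) P) -
    ∑ β ∈ Finset.univ.erase α, 1 / (conj (eta N α) - conj (eta N β)) ^ 2 *
      MvPolynomial.eval (Fin.cons (eta N β) (Fin.cons (eta N α) (Fin.cons (eta N α) b :
      Fin (K + 1) → ℂ) : Fin (K + 2) → ℂ) : Fin (K + 3) → ℂ) P = 0 := by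
  rw [sum_sum_mul_eval_cons_eq _ _ _ _ (-eta N α) (fun k => (k : ℂ) + 1 - (N + 1) / 2)
    (hP.sum_eta_pow_div_conj α),
    sum_mul_eval_cons_eq _ _ _ _ ((-eta N α) ^ 2) (fun k => -((N : ℂ) ^ 2 - 1) / 12 -
      ((k : ℂ) + 1) * ((k : ℂ) + 1 - N) / 2) (hP.sum_eta_pow_div_conj_sq α),
    ← mul_sub, ← moment_sub, mul_eq_zero]
  right
  have h := hP.moment_quadratic (eta N α) b
    ((1 - (N + 1 : ℂ) / 2) ^ 2 + (N ^ 2 - 1) / 12 + (1 - N) / 2)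
    (1 - (N + 1 : ℂ) / 2 + (2 - N) / 2) (1 - (N + 1 : ℂ) / 2) (1 / 2)
  rw [← h]
  congr 1
  funext k l m
  ring

theorem IsLatticePoly.sum_eval_cons {M : ℕ} {P : MvPolynomial (Fin (M + 1)) ℂ}
    (hP : IsLatticePoly N P) (b : Fin M → ℂ) :
    ∑ β : Fin N, MvPolynomial.eval (Fin.cons (eta N β) b : Fin (M + 1) → ℂ) P = 0 := by
  simp only [MvPolynomial.eval_eq', Fin.prod_univ_succ, Fin.cons_zero, Fin.cons_succ]
  rw [Finset.sum_comm]
  refine Finset.sum_eq_zero fun d hd => ?_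
  have := hP.exponent d hd 0
  rw [← Finset.mul_sum, ← Finset.sum_mul, sum_eta_pow this.1 (by omega), zero_mul, mul_zero]

end Moments

/-! ### Annihilation operators -/

section Annihilation

variable {N M : ℕ}

/-- The restriction of a polynomial to the lattice. -/
noncomputable def latticeFn (N : ℕ) (P : MvPolynomial (Fin M) ℂ) (a : Fin M → Fin N) : ℂ :=
  MvPolynomial.eval (fun i => eta N (a i)) P

theorem eta_cons (β : Fin N) (b : Fin M → Fin N) :
    (fun i => eta N ((Fin.cons β b : Fin (M + 1) → Fin N) i)) =
      (Fin.cons (eta N β) (fun i => eta N (b i)) : Fin (M + 1) → ℂ) := by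
  ext i
  refine Fin.cases ?_ (fun j => ?_) i <;> simp

theorem isLatticePoly_wavePoly (n : ℕ) : IsLatticePoly (2 * n) (wavePoly n) where
  symm := rename_wavePoly
  exponent _ hd i := wavePoly_exponent hd i
  triple z i j k hij hik hjk h1 h2 := by
    rw [eval_wavePoly, waveFunction_eq_zero hij hik hjk h1 h2]

theorem psi0_eq_ket (n : ℕ) : psi0 n = ket (latticeFn (2 * n) (wavePoly n)) := by
  simp only [psi0, ket, latticeFn, eval_wavePoly]
  rfl

theorem IsLatticePoly.isAdmissible {P : MvPolynomial (Fin M) ℂ} (hP : IsLatticePoly N P) :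
    IsAdmissible (latticeFn N P) where
  symm σ a := by
    rw [latticeFn, latticeFn]
    conv_rhs => rw [← hP.symm σ, MvPolynomial.eval_rename]
    rfl
  triple a α h := by
    have h' : 2 < (Finset.univ.filter fun i => a i = α).card := by
      rwa [Finset.card_filter]
    obtain ⟨i, hi, j, hj, k, hk, hij, hik, hjk⟩ := Finset.two_lt_card.mp h'
    simp only [Finset.mem_filter, Finset.mem_univ, true_and] at hi hj hk
    exact hP.triple _ i j k hij hik hjk (by simp only [hi, hj]) (by simp only [hi, hk])

theorem ket_sum {ι : Type*} (s : Finset ι) (F : ι → (Fin M → Fin N) → ℂ) :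
    ∑ i ∈ s, ket (F i) = ket fun b => ∑ i ∈ s, F i b := by
  simp only [ket, Finset.sum_smul]
  rw [Finset.sum_comm]

theorem smul_ket (c : ℂ) (ψ : (Fin M → Fin N) → ℂ) : c • ket ψ = ket fun b => c * ψ b := by
  simp only [ket, Finset.smul_sum, mul_smul]

theorem ket_sub (ψ φ : (Fin M → Fin N) → ℂ) : ket ψ - ket φ = ket fun b => ψ b - φ b := by
  simp only [ket, sub_smul, Finset.sum_sub_distrib]

theorem ket_eq_zero {ψ : (Fin M → Fin N) → ℂ} (h : ∀ b, ψ b = 0) : ket ψ = 0 := by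
  simp [ket, h]

theorem Sm_mul_three_mulVec_ket {ψ : (Fin (M + 3) → Fin N) → ℂ} (h : IsAdmissible ψ)
    (α β γ : Fin N) :
    (Sm α * Sm β * Sm γ) *ᵥ ket ψ = ((M + 3 : ℂ) * (M + 2) * (M + 1)) •
      ket fun b : Fin M → Fin N => ψ (Fin.cons γ (Fin.cons β (Fin.cons α b :
        Fin (M + 1) → Fin N) : Fin (M + 2) → Fin N)) := by
  rw [← Matrix.mulVec_mulVec, Sm_mulVec_ket h, ← Matrix.mulVec_mulVec, Matrix.mulVec_smul,
    Sm_mulVec_ket (h.cons γ), smul_smul, Matrix.mulVec_smul, Sm_mulVec_ket ((h.cons γ).cons β),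
    smul_smul]
  congr 1
  push_cast
  ring

/-- Three lowerings annihilate a state with at most two coordinates; this covers the chain with N =
2. -/
theorem Sm_mul_three_mulVec_ket_of_le (hM : M ≤ 2) {ψ : (Fin M → Fin N) → ℂ}
    (h : IsAdmissible ψ) (α β γ : Fin N) : (Sm α * Sm β * Sm γ) *ᵥ ket ψ = 0 := by
  simp only [← Matrix.mulVec_mulVec]
  match M, hM, ψ, h with
  | 0, _, ψ, h => simp only [Sm_mulVec_ket_zero, Matrix.mulVec_zero]
  | 1, _, ψ, h =>
    rw [Sm_mulVec_ket h, Matrix.mulVec_smul, Sm_mulVec_ket_zero, smul_zero, Matrix.mulVec_zero]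
  | 2, _, ψ, h =>
    rw [Sm_mulVec_ket h, Matrix.mulVec_smul, Sm_mulVec_ket (h.cons γ), smul_smul,
      Matrix.mulVec_smul, Sm_mulVec_ket_zero, smul_zero]

variable {P : MvPolynomial (Fin M) ℂ}

theorem IsLatticePoly.sum_smul_mulVec_ket (hP : IsLatticePoly N P) (α : Fin N) (c : Fin N → ℂ)
    (h : ∀ {K : ℕ} {Q : MvPolynomial (Fin (K + 3)) ℂ}, IsLatticePoly N Q → ∀ b : Fin K → ℂ,
      ∑ β ∈ Finset.univ.erase α, c β * MvPolynomial.eval (Fin.cons (eta N β) (Fin.cons (eta N α)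
      (Fin.cons (eta N α) b : Fin (K + 1) → ℂ) : Fin (K + 2) → ℂ) : Fin (K + 3) → ℂ) Q = 0) :
    (∑ β ∈ Finset.univ.erase α, c β • (Sm α ^ 2 * Sm β)) *ᵥ ket (latticeFn N P) = 0 := by
  simp only [Matrix.sum_mulVec, Matrix.smul_mulVec, sq]
  rcases Nat.lt_or_ge 2 M with hM | hM
  · obtain ⟨K, rfl⟩ := Nat.exists_eq_add_of_le' hM
    simp only [Sm_mul_three_mulVec_ket hP.isAdmissible]
    simp only [smul_ket, ket_sum, latticeFn, eta_cons]
    refine ket_eq_zero fun b => ?_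
    simp only [mul_left_comm _ ((K + 3 : ℂ) * (K + 2) * (K + 1)), ← Finset.mul_sum]
    rw [h hP, mul_zero]
  · simp only [Sm_mul_three_mulVec_ket_of_le hM hP.isAdmissible, smul_zero, Finset.sum_const_zero]

theorem IsLatticePoly.sum_sum_smul_mulVec_ket (hP : IsLatticePoly N P) (α : Fin N) (c : Fin N → ℂ)
    (h : ∀ {K : ℕ} {Q : MvPolynomial (Fin (K + 3)) ℂ}, IsLatticePoly N Q → ∀ b : Fin K → ℂ,
      (∑ β ∈ Finset.univ.erase α, ∑ γ ∈ Finset.univ.erase α, 1 / c β * (1 / c γ) *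
        MvPolynomial.eval (Fin.cons (eta N γ) (Fin.cons (eta N β) (Fin.cons (eta N α) b :
        Fin (K + 1) → ℂ) : Fin (K + 2) → ℂ) : Fin (K + 3) → ℂ) Q) -
      ∑ β ∈ Finset.univ.erase α, 1 / c β ^ 2 * MvPolynomial.eval (Fin.cons (eta N β)
        (Fin.cons (eta N α) (Fin.cons (eta N α) b : Fin (K + 1) → ℂ) : Fin (K + 2) → ℂ) :
        Fin (K + 3) → ℂ) Q = 0) :
    ((∑ β ∈ Finset.univ.erase α, ∑ γ ∈ Finset.univ.erase α,
        (1 / (c β * c γ)) • (Sm α * Sm β * Sm γ)) -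
      ∑ β ∈ Finset.univ.erase α, (1 / c β ^ 2) • (Sm α ^ 2 * Sm β)) *ᵥ ket (latticeFn N P) = 0 := by
  simp only [Matrix.sub_mulVec, Matrix.sum_mulVec, Matrix.smul_mulVec, sq (Sm α)]
  rcases Nat.lt_or_ge 2 M with hM | hM
  · obtain ⟨K, rfl⟩ := Nat.exists_eq_add_of_le' hM
    simp only [Sm_mul_three_mulVec_ket hP.isAdmissible]
    simp only [smul_ket, ket_sum, latticeFn, eta_cons, ket_sub, ← _root_.one_div_mul_one_div]
    refine ket_eq_zero fun b => ?_
    simp only [mul_left_comm _ ((K + 3 : ℂ) * (K + 2) * (K + 1)), ← Finset.mul_sum, ← mul_sub]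
    rw [h hP, mul_zero]
  · simp only [Sm_mul_three_mulVec_ket_of_le hM hP.isAdmissible, smul_zero, Finset.sum_const_zero,
      sub_zero]

theorem Omega_mulVec_psi0 (n : ℕ) (α : Fin (2 * n)) : Omega (2 * n) α *ᵥ psi0 n = 0 := by
  rw [psi0_eq_ket]
  exact (isLatticePoly_wavePoly n).sum_smul_mulVec_ket α _ fun hQ => hQ.omega α

theorem OmegaBar_mulVec_psi0 (n : ℕ) (α : Fin (2 * n)) : OmegaBar (2 * n) α *ᵥ psi0 n = 0 := by
  rw [psi0_eq_ket]
  exact (isLatticePoly_wavePoly n).sum_smul_mulVec_ket α _ fun hQ => hQ.omegaBar α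

theorem Xi_mulVec_psi0 (n : ℕ) (α : Fin (2 * n)) : Xi (2 * n) α *ᵥ psi0 n = 0 := by
  rw [psi0_eq_ket]
  exact (isLatticePoly_wavePoly n).sum_sum_smul_mulVec_ket α
    (fun β => eta (2 * n) α - eta (2 * n) β) fun hQ => hQ.xi α

theorem XiBar_mulVec_psi0 (n : ℕ) (α : Fin (2 * n)) : XiBar (2 * n) α *ᵥ psi0 n = 0 := by
  rw [psi0_eq_ket]
  exact (isLatticePoly_wavePoly n).sum_sum_smul_mulVec_ket α
    (fun β => conj (eta (2 * n) α) - conj (eta (2 * n) β)) fun hQ => hQ.xiBar α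

theorem psi0_ne_zero (n : ℕ) : psi0 n ≠ 0 := by
  intro h
  rw [psi0_eq_ket] at h
  have h1 := (isLatticePoly_wavePoly n).isAdmissible.eq_zero_of_ket_eq_zero h
    -- The configuration with the first n sites doubly occupied.
    fun i => ⟨(block i : ℕ), by omega⟩
  rw [latticeFn, eval_wavePoly] at h1
  refine waveFunction_block_ne_zero (fun k : Fin n => eta (2 * n) ⟨(k : ℕ), by omega⟩) ?_
    (fun k => eta_ne_zero _) h1
  intro k l hkl
  simpa [Fin.ext_iff] using eta_injective hkl

/-! ### The singlet property -/

theorem IsLatticePoly.sum_Sm_mulVec_ket (hP : IsLatticePoly N P) :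
    (∑ α, Sm α) *ᵥ ket (latticeFn N P) = 0 := by
  simp only [Matrix.sum_mulVec]
  match M, P, hP with
  | 0, P, hP => simp only [Sm_mulVec_ket_zero, Finset.sum_const_zero]
  | M + 1, P, hP =>
    simp only [Sm_mulVec_ket hP.isAdmissible, ← Finset.smul_sum, ket_sum, latticeFn, eta_cons,
      hP.sum_eval_cons]
    rw [ket_eq_zero fun _ => rfl, smul_zero]

theorem sp_mul_sm : sp * sm = sm * sp + (2 : ℂ) • sz := by
  have := sqrt_two_mul_self
  ext i j
  fin_cases i <;> fin_cases j <;>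
    simp [sp, sm, sz, Matrix.mul_apply, Fin.sum_univ_three, this]

theorem sz_mul_sp : sz * sp = sp * sz + sp := by
  ext i j
  fin_cases i <;> fin_cases j <;> simp [sp, sz, Matrix.mul_apply, Fin.sum_univ_three]

theorem sz_mul_sm : sz * sm = sm * sz - sm := by
  ext i j
  fin_cases i <;> fin_cases j <;> simp [sm, sz, Matrix.mul_apply, Fin.sum_univ_three]

theorem sp_conjTranspose : spᴴ = sm := by
  ext i j
  fin_cases i <;> fin_cases j <;> simp [sp, sm]

theorem sum_site_mul_sum_site (s : Finset (Fin N)) (c d : Fin N → ℂ)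
    (A B C : Matrix (Fin 3) (Fin 3) ℂ) (h : A * B = B * A + C) :
    (∑ α ∈ s, c α • site α A) * (∑ α ∈ s, d α • site α B) =
      (∑ α ∈ s, d α • site α B) * (∑ α ∈ s, c α • site α A) +
        ∑ α ∈ s, (c α * d α) • site α C := by
  have h1 : ∀ α β : Fin N, site α A * site β B =
      site β B * site α A + if α = β then site α C else 0 := by
    intro α β
    by_cases hαβ : α = β
    · subst hαβ
      rw [if_pos rfl, site_mul, h, site_add, site_mul]
    · rw [if_neg hαβ, add_zero, site_commute hαβ]
  simp only [Finset.sum_mul_sum, smul_mul_smul_comm, h1, smul_add, Finset.sum_add_distrib]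
  congr 1
  · rw [Finset.sum_comm]
    simp only [mul_comm]
  · refine Finset.sum_congr rfl fun α hα => ?_
    simp [Finset.sum_ite_eq, hα]

open scoped ComplexOrder in
-- ‖S⁺ψ‖² = ⟨ψ, S⁻S⁺ψ⟩ for the total spin, and S⁻S⁺ = S⁺S⁻ - 2Sᶻ annihilates ψ.
theorem sum_Sp_mulVec_eq_zero {ψ : State N} (hm : (∑ α, Sm α) *ᵥ ψ = 0)
    (hz : (∑ α, Sz α) *ᵥ ψ = 0) : (∑ α, Sp α) *ᵥ ψ = 0 := by
  have hc := sum_site_mul_sum_site (N := N) Finset.univ (fun _ => 1) (fun _ => 1) sp sm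
    ((2 : ℂ) • sz) sp_mul_sm
  simp only [one_smul, mul_one, site_smul, ← Finset.smul_sum] at hc
  have hadj : (∑ α : Fin N, Sp α)ᴴ = ∑ α, Sm α := by
    simp only [Sp, Sm, Matrix.conjTranspose_sum, site_conjTranspose, sp_conjTranspose]
  have h1 : (∑ α : Fin N, Sm α) *ᵥ ((∑ α, Sp α) *ᵥ ψ) = 0 := by
    have h2 := congrArg (fun A : Op N => A *ᵥ ψ) hc
    simp only [Matrix.add_mulVec, ← Matrix.mulVec_mulVec, Matrix.smul_mulVec] at h2
    simp only [Sm, Sz, Sp] at hm hz ⊢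
    rw [hm, hz, Matrix.mulVec_zero, smul_zero, add_zero] at h2
    exact h2.symm
  rw [← dotProduct_star_self_eq_zero, Matrix.star_mulVec, hadj,
    ← Matrix.dotProduct_mulVec, h1, dotProduct_zero]

end Annihilation

/-! ### Vector operators on a spin-one multiplet -/

section VectorOperators

variable {V : Type*} [AddCommGroup V] [Module ℂ V]

/-- If the lowest component of the coupling of a vector operator `K` and a triplet `u, v, w` to
spin two vanishes, then so do the other components. -/
theorem vectorOperator_ladder {Kp Km Kz Jp : Module.End ℂ V} {u v w : V}
    (hm : ∀ x, Jp (Km x) = Km (Jp x) + (2 : ℂ) • Kz x) (hz : ∀ x, Jp (Kz x) = Kz (Jp x) - Kp x)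
    (hp : ∀ x, Jp (Kp x) = Kp (Jp x)) (hu : Jp u = -v) (hv : Jp v = -(2 : ℂ) • w) (hw : Jp w = 0)
    (h : Km u = 0) :
    (2 : ℂ) • Kz u = Km v ∧ Km w = Kp u + (2 : ℂ) • Kz v ∧ (2 : ℂ) • Kz w = -Kp v ∧ Kp w = 0 := by
  have r1 : (2 : ℂ) • Kz u = Km v := by
    have := congrArg Jp h
    rw [hm, hu, map_neg, map_zero] at this
    linear_combination (norm := module) this
  have r2 : Km w = Kp u + (2 : ℂ) • Kz v := by
    have := congrArg Jp r1
    rw [map_smul, hz, hm, hu, hv, map_neg, map_smul] at this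
    linear_combination (norm := module) (1 / 2 : ℂ) • this
  have r3 : (2 : ℂ) • Kz w = -Kp v := by
    have := congrArg Jp r2
    rw [map_add, map_smul, hm, hp, hz, hu, hv, hw, map_neg, map_smul, map_zero] at this
    linear_combination (norm := module) (1 / 3 : ℂ) • this
  refine ⟨r1, r2, r3, ?_⟩
  have := congrArg Jp r3
  rw [map_smul, map_neg, hz, hp, hv, hw, map_smul, map_zero] at this
  linear_combination (norm := module) (-1 / 4 : ℂ) • this

variable {Kp Km Kz Lp Lm Lz Mp Mm Mz : Module.End ℂ V} {u v w : V}

/-- This and the next two lemmas are the three components of {S_α·L, S_α·K}ψ = (8 L·K + 4 S_α·M)ψ,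
where M stems from the commutators of K and L. In Cartesian components the absence of spin two reads
K_aψ_b + K_bψ_a = (2/3) δ_ab K·ψ, and similarly for L. Up to commutators it turns S_α·L S_α·K ψ into
2 L·K ψ_b - (2/3) L_b(K·ψ), and a second use gives L_b(K·ψ) + K_b(L·ψ) = -6 L·K ψ_b; hence 4 + 4 =
8. -/
theorem scalar_product_top
    (hmp : ∀ x, Km (Lp x) = Lp (Km x) - (2 : ℂ) • Mz x)
    (hpm : ∀ x, Kp (Lm x) = Lm (Kp x) + (2 : ℂ) • Mz x)
    (hzm : ∀ x, Kz (Lm x) = Lm (Kz x) - Mm x) (hmz : ∀ x, Km (Lz x) = Lz (Km x) + Mm x)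
    (hzz : ∀ x, Kz (Lz x) = Lz (Kz x))
    (k0 : Km u = 0) (k1 : (2 : ℂ) • Kz u = Km v) (k2 : Km w = Kp u + (2 : ℂ) • Kz v)
    (l0 : Lm u = 0) (l1 : (2 : ℂ) • Lz u = Lm v) (l2 : Lm w = Lp u + (2 : ℂ) • Lz v) :
    Lz (Kz u + (1 / 2 : ℂ) • Km v) + (1 / 2 : ℂ) • Lm (Km w + Kp u) +
      (Kz (Lz u + (1 / 2 : ℂ) • Lm v) + (1 / 2 : ℂ) • Km (Lm w + Lp u)) =
    (8 : ℂ) • (Lz (Kz u) + (1 / 2 : ℂ) • (Lp (Km u) + Lm (Kp u))) +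
      (4 : ℂ) • (Mz u + (1 / 2 : ℂ) • Mm v) := by
  rw [← k1, ← l1, k2, l2, k0]
  have e1 := hpm u
  have e2 := hmp u
  have e3 := hzm v
  have e4 := hmz v
  rw [l0, map_zero] at e1
  rw [k0, map_zero] at e2
  rw [← l1, map_smul, hzz] at e3
  rw [← k1, map_smul] at e4
  simp only [map_add, map_smul, map_zero, hzz, e4, e2]
  linear_combination (norm := module) (3 : ℂ) • e1 - e3

theorem scalar_product_middle
    (hmp : ∀ x, Km (Lp x) = Lp (Km x) - (2 : ℂ) • Mz x)
    (hpm : ∀ x, Kp (Lm x) = Lm (Kp x) + (2 : ℂ) • Mz x)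
    (hpz : ∀ x, Kp (Lz x) = Lz (Kp x) - Mp x) (hmz : ∀ x, Km (Lz x) = Lz (Km x) + Mm x)
    (k1 : (2 : ℂ) • Kz u = Km v) (k2 : Km w = Kp u + (2 : ℂ) • Kz v)
    (k3 : (2 : ℂ) • Kz w = -Kp v)
    (l1 : (2 : ℂ) • Lz u = Lm v) (l3 : (2 : ℂ) • Lz w = -Lp v) :
    Lm (-Kz w + (1 / 2 : ℂ) • Kp v) + Lp (Kz u + (1 / 2 : ℂ) • Km v) +
      (Km (-Lz w + (1 / 2 : ℂ) • Lp v) + Kp (Lz u + (1 / 2 : ℂ) • Lm v)) =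
    (8 : ℂ) • (Lz (Kz v) + (1 / 2 : ℂ) • (Lp (Km v) + Lm (Kp v))) +
      (4 : ℂ) • (Mm w + Mp u) := by
  have a1 := congrArg Lp k1
  have a2 := congrArg Lm k3
  have a3 := congrArg Kp l1
  have a4 := congrArg Km l3
  have a5 := congrArg Lz k2
  have e1 := hmz w
  have e2 := hpz u
  have e3 := hpm v
  have e4 := hmp v
  simp only [map_add, map_smul, map_neg] at a1 a2 a3 a4 a5 ⊢
  linear_combination (norm := module) (1 / 2 : ℂ) • a1 - (1 / 2 : ℂ) • a2 + (5 / 2 : ℂ) • a3 -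
    (5 / 2 : ℂ) • a4 + (4 : ℂ) • a5 + (4 : ℂ) • e1 - (4 : ℂ) • e2 + (3 : ℂ) • e3 + (3 : ℂ) • e4

theorem scalar_product_bottom
    (hmp : ∀ x, Km (Lp x) = Lp (Km x) - (2 : ℂ) • Mz x)
    (hpm : ∀ x, Kp (Lm x) = Lm (Kp x) + (2 : ℂ) • Mz x)
    (hzp : ∀ x, Kz (Lp x) = Lp (Kz x) + Mp x) (hpz : ∀ x, Kp (Lz x) = Lz (Kp x) - Mp x)
    (hzz : ∀ x, Kz (Lz x) = Lz (Kz x))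
    (k2 : Km w = Kp u + (2 : ℂ) • Kz v) (k3 : (2 : ℂ) • Kz w = -Kp v) (k4 : Kp w = 0)
    (l2 : Lm w = Lp u + (2 : ℂ) • Lz v) (l3 : (2 : ℂ) • Lz w = -Lp v) (l4 : Lp w = 0) :
    -Lz (-Kz w + (1 / 2 : ℂ) • Kp v) + (1 / 2 : ℂ) • Lp (Km w + Kp u) +
      (-Kz (-Lz w + (1 / 2 : ℂ) • Lp v) + (1 / 2 : ℂ) • Kp (Lm w + Lp u)) =
    (8 : ℂ) • (Lz (Kz w) + (1 / 2 : ℂ) • (Lp (Km w) + Lm (Kp w))) +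
      (4 : ℂ) • (-Mz w + (1 / 2 : ℂ) • Mp v) := by
  have a2 := congrArg Lp k2
  have a3 := congrArg Lz k3
  have a4 := congrArg Lm k4
  have b2 := congrArg Kp l2
  have b3 := congrArg Kz l3
  have b4 := congrArg Km l4
  have e1 := hpm w
  have e2 := hmp w
  have e3 := hzp v
  have e4 := hpz v
  have e5 := hzz w
  simp only [map_add, map_smul, map_neg, map_zero] at a2 a3 a4 b2 b3 b4 ⊢
  linear_combination (norm := module) (-1 / 2 : ℂ) • a2 - (3 / 2 : ℂ) • a3 - (3 : ℂ) • a4 -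
    (1 / 2 : ℂ) • b2 - (3 / 2 : ℂ) • b3 - (3 : ℂ) • b4 + e1 + (3 : ℂ) • e2 + e3 - e4 + (4 : ℂ) • e5

end VectorOperators

/-! ### Decomposition with respect to one site -/

section Component

variable {N : ℕ}

/-- The component of a state along the basis state `m` of the site `α`. -/
def component (α : Fin N) (m : Fin 3) : Module.End ℂ (State N) where
  toFun f s := f (Function.update s α m)
  map_add' _ _ := rfl
  map_smul' _ _ := rfl

theorem component_ext (α : Fin N) {f g : State N} (h : ∀ m, component α m f = component α m g) :
    f = g := by
  ext s
  have := congrFun (h (s α)) s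
  simpa [component] using this

theorem component_site_same (α : Fin N) (m : Fin 3) (A : Matrix (Fin 3) (Fin 3) ℂ) (f : State N) :
    component α m (site α A *ᵥ f) = ∑ k, A m k • component α k f := by
  ext s
  simp [component, site_mulVec, Finset.sum_apply]

theorem component_site_of_ne {α β : Fin N} (h : β ≠ α) (m : Fin 3)
    (A : Matrix (Fin 3) (Fin 3) ℂ) (f : State N) :
    component α m (site β A *ᵥ f) = site β A *ᵥ component α m f := by
  ext s
  simp only [component, site_mulVec, LinearMap.coe_mk, AddHom.coe_mk, Function.update_of_ne h]
  refine Finset.sum_congr rfl fun k _ => ?_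
  rw [Function.update_comm h]

/-- `∑_{β ≠ α} w_β A_β` for a one-site operator `A`. -/
noncomputable def envOp (α : Fin N) (w : Fin N → ℂ) (A : Matrix (Fin 3) (Fin 3) ℂ) : Op N :=
  ∑ β ∈ Finset.univ.erase α, w β • site β A

theorem component_envOp (α : Fin N) (m : Fin 3) (w : Fin N → ℂ) (A : Matrix (Fin 3) (Fin 3) ℂ)
    (f : State N) : component α m (envOp α w A *ᵥ f) = envOp α w A *ᵥ component α m f := by
  simp only [envOp, Matrix.sum_mulVec, Matrix.smul_mulVec, map_sum, map_smul]
  exact Finset.sum_congr rfl fun β hβ => by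
    rw [component_site_of_ne (Finset.ne_of_mem_erase hβ)]

theorem envOp_mul (α : Fin N) (w w' : Fin N → ℂ) {A B C : Matrix (Fin 3) (Fin 3) ℂ}
    (h : A * B = B * A + C) :
    envOp α w A * envOp α w' B =
      envOp α w' B * envOp α w A + envOp α (fun β => w β * w' β) C :=
  sum_site_mul_sum_site _ _ _ _ _ _ h

theorem envOp_smul (α : Fin N) (w : Fin N → ℂ) (c : ℂ) (A : Matrix (Fin 3) (Fin 3) ℂ) :
    envOp α w (c • A) = c • envOp α w A := by
  simp only [envOp, site_smul, Finset.smul_sum, smul_comm c]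

theorem envOp_zero (α : Fin N) (w : Fin N → ℂ) : envOp α w 0 = 0 := by
  have := envOp_smul α w 0 0
  rwa [zero_smul, zero_smul] at this

/-- `∑_{β ≠ α} w_β 𝐒_α · 𝐒_β`. -/
noncomputable def dotEnv (α : Fin N) (w : Fin N → ℂ) : Op N :=
  ∑ β ∈ Finset.univ.erase α, w β • dotS α β

theorem dotS_eq (α β : Fin N) :
    dotS α β = site α sz * site β sz +
      (1 / 2 : ℂ) • (site α sp * site β sm + site α sm * site β sp) := by
  simp only [dotS, Sx, Sy, Sz, sx, sy, site_smul, site_add, site_sub, smul_mul_smul_comm]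
  have h : (1 / (2 * Complex.I) * (1 / (2 * Complex.I)) : ℂ) = -(1 / 4) := by
    rw [div_mul_div_comm, mul_mul_mul_comm, Complex.I_mul_I]
    norm_num
  rw [h]
  simp only [mul_add, add_mul, mul_sub, sub_mul]
  module

theorem dotEnv_eq (α : Fin N) (w : Fin N → ℂ) :
    dotEnv α w = site α sz * envOp α w sz +
      (1 / 2 : ℂ) • (site α sp * envOp α w sm + site α sm * envOp α w sp) := by
  simp only [dotEnv, envOp, dotS_eq, Finset.mul_sum, Finset.smul_sum, smul_add,
    Finset.sum_add_distrib, mul_smul_comm, smul_comm (1 / 2 : ℂ)]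

/-- The scalar product of two vector operators `∑_{β ≠ α} w_β 𝐒_β`. -/
noncomputable def envDot (α : Fin N) (w w' : Fin N → ℂ) : Op N :=
  envOp α w sz * envOp α w' sz +
    (1 / 2 : ℂ) • (envOp α w sp * envOp α w' sm + envOp α w sm * envOp α w' sp)

theorem envDot_eq (α : Fin N) (w w' : Fin N → ℂ) :
    envDot α w w' = ∑ β ∈ Finset.univ.erase α, ∑ γ ∈ Finset.univ.erase α,
      (w β * w' γ) • dotS β γ := by
  simp only [envDot, envOp, dotS_eq, Finset.sum_mul_sum, Finset.smul_sum, smul_add,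
    Finset.sum_add_distrib, smul_mul_smul_comm, smul_comm (1 / 2 : ℂ)]

/-- Multiplying the middle component by √2 removes all square roots, which is the form used in
`vectorOperator_ladder`. -/
theorem component_dotEnv (α : Fin N) (w : Fin N → ℂ) (f : State N) :
    component α 0 (dotEnv α w *ᵥ f) = envOp α w sz *ᵥ component α 0 f +
      (1 / 2 : ℂ) • envOp α w sm *ᵥ ((Real.sqrt 2 : ℂ) • component α 1 f) ∧
    (Real.sqrt 2 : ℂ) • component α 1 (dotEnv α w *ᵥ f) = envOp α w sm *ᵥ component α 2 f +
      envOp α w sp *ᵥ component α 0 f ∧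
    component α 2 (dotEnv α w *ᵥ f) = -(envOp α w sz *ᵥ component α 2 f) +
      (1 / 2 : ℂ) • envOp α w sp *ᵥ ((Real.sqrt 2 : ℂ) • component α 1 f) := by
  have h2 := sqrt_two_mul_self
  simp only [dotEnv_eq, Matrix.add_mulVec, Matrix.smul_mulVec, ← Matrix.mulVec_mulVec, map_add,
    map_smul, component_site_same, component_envOp, Fin.sum_univ_three, Matrix.mulVec_smul]
  refine ⟨?_, ?_, ?_⟩
  · simp [sz, sp, sm]
  · have h3 : (Real.sqrt 2 : ℂ) * (2⁻¹ * (Real.sqrt 2 : ℂ)) = 1 := by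
      linear_combination (1 / 2 : ℂ) * h2
    simp [-Complex.coe_smul, sz, sp, sm, smul_smul, h3]
  · simp [sz, sp, sm]

variable {α : Fin N} {ψ : State N}

/-- The components of a singlet with respect to the site `α`. -/
theorem component_singlet {A : Matrix (Fin 3) (Fin 3) ℂ} (h : (∑ β, site β A) *ᵥ ψ = 0)
    (m : Fin 3) :
    envOp α (fun _ => 1) A *ᵥ component α m ψ = -∑ k, A m k • component α k ψ := by
  have h1 : (∑ β, site β A) = site α A + envOp α (fun _ => 1) A := by
    simp only [envOp, one_smul]
    exact (Finset.add_sum_erase _ _ (Finset.mem_univ α)).symm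
  rw [h1, Matrix.add_mulVec] at h
  have h2 := congrArg (component α m) h
  rw [map_add, component_site_same, component_envOp, map_zero] at h2
  exact eq_neg_of_add_eq_zero_right h2

/-- (S⁻_α)² carries only the top component at α to the bottom one, so the hypothesis `hΩ` says that
the environment operator K⁻ kills the top component of ψ. Since total S⁺ annihilates ψ, the raising
operator of the other sites moves the three components as a triplet, and `vectorOperator_ladder`
yields the other four relations. -/
theorem component_ladder (hp : (∑ β, Sp β) *ᵥ ψ = 0) {w : Fin N → ℂ}
    (hΩ : (∑ β ∈ Finset.univ.erase α, w β • (Sm α ^ 2 * Sm β)) *ᵥ ψ = 0) :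
    envOp α w sm *ᵥ component α 0 ψ = 0 ∧
    (2 : ℂ) • envOp α w sz *ᵥ component α 0 ψ =
      envOp α w sm *ᵥ ((Real.sqrt 2 : ℂ) • component α 1 ψ) ∧
    envOp α w sm *ᵥ component α 2 ψ = envOp α w sp *ᵥ component α 0 ψ +
      (2 : ℂ) • envOp α w sz *ᵥ ((Real.sqrt 2 : ℂ) • component α 1 ψ) ∧
    (2 : ℂ) • envOp α w sz *ᵥ component α 2 ψ =
      -(envOp α w sp *ᵥ ((Real.sqrt 2 : ℂ) • component α 1 ψ)) ∧
    envOp α w sp *ᵥ component α 2 ψ = 0 := by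
  have h2 := sqrt_two_mul_self
  have k0 : envOp α w sm *ᵥ component α 0 ψ = 0 := by
    have h1 : (∑ β ∈ Finset.univ.erase α, w β • (Sm α ^ 2 * Sm β)) =
        site α (sm * sm) * envOp α w sm := by
      simp only [envOp, Finset.mul_sum, mul_smul_comm, sq, Sm, site_mul]
    rw [h1, ← Matrix.mulVec_mulVec] at hΩ
    have h3 := congrArg (component α 2) hΩ
    rw [component_site_same, map_zero] at h3
    simpa [sm, Matrix.mul_apply, Fin.sum_univ_three, component_envOp] using h3
  have hs := fun m => component_singlet (α := α) (A := sp) hp m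
  have comm : ∀ {A C : Matrix (Fin 3) (Fin 3) ℂ}, sp * A = A * sp + C → ∀ x : State N,
      envOp α (fun _ => 1) sp *ᵥ (envOp α w A *ᵥ x) =
        envOp α w A *ᵥ (envOp α (fun _ => 1) sp *ᵥ x) + envOp α w C *ᵥ x := by
    intro A C h x
    rw [Matrix.mulVec_mulVec, envOp_mul α _ _ h, Matrix.add_mulVec, ← Matrix.mulVec_mulVec]
    simp only [one_mul]
  refine ⟨k0, vectorOperator_ladder (V := State N) (Kp := (envOp α w sp).mulVecLin)
    (Km := (envOp α w sm).mulVecLin) (Kz := (envOp α w sz).mulVecLin)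
    (Jp := (envOp α (fun _ => 1) sp).mulVecLin) (u := component α 0 ψ)
    (v := (Real.sqrt 2 : ℂ) • component α 1 ψ) (w := component α 2 ψ) ?_ ?_ ?_ ?_ ?_ ?_ k0⟩
  · intro x
    simp only [Matrix.mulVecLin_apply]
    rw [comm sp_mul_sm, envOp_smul, Matrix.smul_mulVec]
  · intro x
    simp only [Matrix.mulVecLin_apply]
    have : sp * sz = sz * sp + (-1 : ℂ) • sp := by rw [sz_mul_sp]; module
    rw [comm this, envOp_smul, Matrix.smul_mulVec]
    module
  · intro x
    simp only [Matrix.mulVecLin_apply]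
    rw [comm (C := 0) (by simp), envOp_zero, Matrix.zero_mulVec, add_zero]
  · simp only [Matrix.mulVecLin_apply, hs]
    simp [sp, Fin.sum_univ_three]
  · simp only [Matrix.mulVecLin_apply, Matrix.mulVec_smul, hs]
    simp [-Complex.coe_smul, sp, Fin.sum_univ_three, smul_smul, h2]
  · simp only [Matrix.mulVecLin_apply, hs]
    simp [sp, Fin.sum_univ_three]

theorem dotEnv_mul_dotEnv_mulVec (hp : (∑ β, Sp β) *ᵥ ψ = 0) {w w' : Fin N → ℂ}
    (hw : (∑ β ∈ Finset.univ.erase α, w β • (Sm α ^ 2 * Sm β)) *ᵥ ψ = 0)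
    (hw' : (∑ β ∈ Finset.univ.erase α, w' β • (Sm α ^ 2 * Sm β)) *ᵥ ψ = 0) :
    (dotEnv α w' * dotEnv α w + dotEnv α w * dotEnv α w') *ᵥ ψ =
      (8 : ℂ) • envDot α w' w *ᵥ ψ + (4 : ℂ) • dotEnv α (fun β => w' β * w β) *ᵥ ψ := by
  obtain ⟨k0, k1, k2, k3, k4⟩ := component_ladder hp hw
  obtain ⟨l0, l1, l2, l3, l4⟩ := component_ladder hp hw'
  obtain ⟨c0, c1, c2⟩ := component_dotEnv α w ψ
  obtain ⟨d0, d1, d2⟩ := component_dotEnv α w' ψ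
  obtain ⟨c0', c1', c2'⟩ := component_dotEnv α w (dotEnv α w' *ᵥ ψ)
  obtain ⟨d0', d1', d2'⟩ := component_dotEnv α w' (dotEnv α w *ᵥ ψ)
  obtain ⟨m0, m1, m2⟩ := component_dotEnv α (fun β => w' β * w β) ψ
  have comm : ∀ {A B C : Matrix (Fin 3) (Fin 3) ℂ}, A * B = B * A + C → ∀ x : State N,
      (envOp α w A).mulVecLin ((envOp α w' B).mulVecLin x) =
        (envOp α w' B).mulVecLin ((envOp α w A).mulVecLin x) +
        (envOp α (fun β => w' β * w β) C).mulVecLin x := by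
    intro A B C h x
    simp only [Matrix.mulVecLin_apply]
    rw [Matrix.mulVec_mulVec, envOp_mul α _ _ h, Matrix.add_mulVec, ← Matrix.mulVec_mulVec]
    simp only [mul_comm]
  have smulLin : ∀ (c : ℂ) (A : Matrix (Fin 3) (Fin 3) ℂ) (x : State N),
      (envOp α (fun β => w' β * w β) (c • A)).mulVecLin x =
      c • (envOp α (fun β => w' β * w β) A).mulVecLin x := by
    intro c A x
    rw [envOp_smul, Matrix.mulVecLin_apply, Matrix.smul_mulVec, Matrix.mulVecLin_apply]
  have hpm := fun x => (comm sp_mul_sm x).trans (by rw [smulLin])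
  have hmp := fun x => (comm (show sm * sp = sp * sm + (-2 : ℂ) • sz by
    rw [sp_mul_sm]; module) x).trans
      (show _ = _ - (2 : ℂ) • (envOp α (fun β => w' β * w β) sz).mulVecLin x by
        rw [smulLin]; module)
  have hzp := comm sz_mul_sp
  have hzm := fun x => (comm (show sz * sm = sm * sz + (-1 : ℂ) • sm by
    rw [sz_mul_sm]; module) x).trans
      (show _ = _ - (envOp α (fun β => w' β * w β) sm).mulVecLin x by
        rw [smulLin]; module)
  have hpz := fun x => (comm (show sp * sz = sz * sp + (-1 : ℂ) • sp by
    rw [sz_mul_sp]; module) x).trans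
      (show _ = _ - (envOp α (fun β => w' β * w β) sp).mulVecLin x by
        rw [smulLin]; module)
  have hmz := comm (show sm * sz = sz * sm + sm by rw [sz_mul_sm]; module)
  have hzz := fun x => (comm (show sz * sz = sz * sz + 0 by rw [add_zero]) x).trans
      (show _ = (envOp α w' sz).mulVecLin ((envOp α w sz).mulVecLin x) by
        rw [envOp_zero]; simp)
  refine component_ext α fun m => ?_
  have hdot : ∀ m, component α m (envDot α w' w *ᵥ ψ) =
      envOp α w' sz *ᵥ (envOp α w sz *ᵥ component α m ψ) +
      (1 / 2 : ℂ) • (envOp α w' sp *ᵥ (envOp α w sm *ᵥ component α m ψ) +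
        envOp α w' sm *ᵥ (envOp α w sp *ᵥ component α m ψ)) := by
    intro m
    simp only [envDot, Matrix.add_mulVec, Matrix.smul_mulVec, ← Matrix.mulVec_mulVec, map_add,
      map_smul, component_envOp]
  simp only [Matrix.add_mulVec, ← Matrix.mulVec_mulVec, map_add, map_smul]
  fin_cases m
  · have := scalar_product_top (Kp := (envOp α w sp).mulVecLin)
      (Km := (envOp α w sm).mulVecLin) (Kz := (envOp α w sz).mulVecLin)
      (Lp := (envOp α w' sp).mulVecLin) (Lm := (envOp α w' sm).mulVecLin)
      (Lz := (envOp α w' sz).mulVecLin)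
      hmp hpm hzm hmz hzz k0 k1 k2 l0 l1 l2
    simp only [Matrix.mulVecLin_apply] at this
    rw [hdot]
    simp only [Fin.zero_eta, c0', d0', c1, d1, c0, d0, m0]
    exact this
  · have := scalar_product_middle (Kp := (envOp α w sp).mulVecLin)
      (Km := (envOp α w sm).mulVecLin) (Kz := (envOp α w sz).mulVecLin)
      (Lp := (envOp α w' sp).mulVecLin) (Lm := (envOp α w' sm).mulVecLin)
      (Lz := (envOp α w' sz).mulVecLin)
      hmp hpm hpz hmz k1 k2 k3 l1 l3
    simp only [Matrix.mulVecLin_apply] at this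
    have h2 : (Real.sqrt 2 : ℂ) ≠ 0 := by simp
    refine smul_right_injective _ h2 ?_
    simp only [smul_add, smul_comm (Real.sqrt 2 : ℂ), Fin.mk_one, c1', d1', c0, d0, c2, d2, m1,
      hdot, Matrix.mulVec_smul] at this ⊢
    exact this
  · have := scalar_product_bottom (Kp := (envOp α w sp).mulVecLin)
      (Km := (envOp α w sm).mulVecLin) (Kz := (envOp α w sz).mulVecLin)
      (Lp := (envOp α w' sp).mulVecLin) (Lm := (envOp α w' sm).mulVecLin)
      (Lz := (envOp α w' sz).mulVecLin)
      hmp hpm hzp hpz hzz k2 k3 k4 l2 l3 l4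
    simp only [Matrix.mulVecLin_apply] at this
    rw [show (⟨2, by omega⟩ : Fin 3) = 2 from rfl, hdot]
    simp only [c2', d2', c1, d1, c2, d2, m2]
    exact this

end Component

/-! ### The Hamiltonian -/

section Hamiltonian

variable {N : ℕ}

theorem one_div_conj_mul (α β : Fin N) :
    1 / (conj (eta N α) - conj (eta N β)) * (1 / (eta N α - eta N β)) =
      1 / ((‖eta N α - eta N β‖ ^ 2 : ℝ) : ℂ) := by
  rw [_root_.one_div_mul_one_div, ← map_sub, Complex.conj_mul']
  norm_cast

/-- Because the terms with β = γ are included, the triple sum factors into products of two sums for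
each α. -/
theorem hamiltonian_eq (N : ℕ) : hamiltonian N =
    (2 * (Real.pi : ℂ) ^ 2 / (N : ℂ) ^ 2) • ∑ α,
      (dotEnv α (fun β => 1 / (conj (eta N α) - conj (eta N β)) * (1 / (eta N α - eta N β))) -
        (1 / 20 : ℂ) •
          (dotEnv α (fun β => 1 / (conj (eta N α) - conj (eta N β))) *
              dotEnv α (fun β => 1 / (eta N α - eta N β)) +
            dotEnv α (fun β => 1 / (eta N α - eta N β)) *
              dotEnv α (fun β => 1 / (conj (eta N α) - conj (eta N β))))) := by
  rw [hamiltonian, Finset.sum_sub_distrib, ← Finset.smul_sum]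
  congr 3
  · simp only [dotEnv, one_div_conj_mul]
  · refine Finset.sum_congr rfl fun α _ => ?_
    rw [dotEnv, dotEnv, Finset.sum_mul_sum, Finset.sum_mul_sum,
      Finset.sum_comm (s := Finset.univ.erase α) (f := fun β γ => (1 / (eta N α - eta N β)) • dotS α β *
        (1 / (conj (eta N α) - conj (eta N γ))) • dotS α γ), ← Finset.sum_add_distrib]
    refine Finset.sum_congr rfl fun β _ => ?_
    rw [← Finset.sum_add_distrib]
    refine Finset.sum_congr rfl fun γ _ => ?_
    rw [smul_mul_smul_comm, smul_mul_smul_comm, smul_add, ← _root_.one_div_mul_one_div,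
      mul_comm (1 / (eta N α - eta N γ))]

/-- `∑_{α ≠ β, γ} 1 / ((η̄_α - η̄_β) (η_α - η_γ))`. -/
noncomputable def pairSum (β γ : Fin N) : ℂ :=
  ∑ α, if α ≠ β ∧ α ≠ γ then
    1 / (conj (eta N α) - conj (eta N β)) * (1 / (eta N α - eta N γ)) else 0

theorem pairSum_self (β : Fin N) : pairSum β β = ((N : ℂ) ^ 2 - 1) / 12 := by
  have hN : 0 < N := (Nat.zero_le _).trans_lt β.2
  have h := sum_eta_pow_div_sq β (k := 1) le_rfl (by omega)
  have h0 := eta_ne_zero β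
  have h1 : pairSum β β = -eta N β * ∑ α ∈ Finset.univ.erase β,
      1 / (eta N β - eta N α) ^ 2 * eta N α ^ 1 := by
    rw [pairSum, ← Finset.sum_filter, Finset.mul_sum]
    refine Finset.sum_congr (by ext; simp) fun α hα => ?_
    have h2 := eta_sub_ne_zero (Finset.ne_of_mem_erase hα)
    have h3 : eta N α - eta N β ≠ 0 := by rw [← neg_sub]; exact neg_ne_zero.mpr h2
    rw [one_div_conj_sub]
    field_simp
    ring
  rw [h1, h]
  push_cast
  field_simp
  ring

theorem sum_div_sub_erase_erase {β γ : Fin N} (h : β ≠ γ) :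
    ∑ α ∈ (Finset.univ.erase β).erase γ, eta N α / (eta N α - eta N β) =
      ((N : ℂ) - 1) / 2 + eta N γ / (eta N β - eta N γ) := by
  have hN : 0 < N := (Nat.zero_le _).trans_lt β.2
  have h0 := eta_ne_zero β
  have h1 := sum_eta_pow_div β (k := 1) le_rfl hN
  have h2 : ∑ α ∈ Finset.univ.erase β, eta N α / (eta N α - eta N β) =
      -∑ α ∈ Finset.univ.erase β, 1 / (eta N β - eta N α) * eta N α ^ 1 := by
    rw [← Finset.sum_neg_distrib]
    refine Finset.sum_congr rfl fun α _ => ?_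
    rw [← neg_sub (eta N β), div_neg]
    ring
  have h3 := Finset.add_sum_erase (Finset.univ.erase β)
    (fun α => eta N α / (eta N α - eta N β)) (Finset.mem_erase.mpr ⟨h.symm, Finset.mem_univ γ⟩)
  rw [h2, h1, ← neg_sub (eta N β), div_neg] at h3
  have h4 : (eta N β)⁻¹ * (((1 : ℕ) - ((N : ℂ) + 1) / 2) * eta N β ^ 1) = (1 - N) / 2 := by
    push_cast
    field_simp
    ring
  rw [h4] at h3
  linear_combination h3

/-- Partial fractions in η_α reduce the sum to a difference of two one-pole sums, in which the parts
proportional to N cancel. -/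
theorem pairSum_of_ne {β γ : Fin N} (h : β ≠ γ) :
    pairSum β γ = -eta N β * (eta N β + eta N γ) / (eta N β - eta N γ) ^ 2 := by
  have hβγ := eta_sub_ne_zero h.symm
  have hγβ := eta_sub_ne_zero h
  have h1 : pairSum β γ = -eta N β / (eta N β - eta N γ) *
      (∑ α ∈ (Finset.univ.erase β).erase γ, eta N α / (eta N α - eta N β) -
        ∑ α ∈ (Finset.univ.erase γ).erase β, eta N α / (eta N α - eta N γ)) := by
    rw [pairSum, ← Finset.sum_filter, Finset.erase_right_comm (a := γ), ← Finset.sum_sub_distrib,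
      Finset.mul_sum]
    refine Finset.sum_congr (by ext; simp [and_comm]) fun α hα => ?_
    simp only [Finset.mem_erase, Finset.mem_univ, and_true] at hα
    have h2 := eta_sub_ne_zero hα.1.symm
    have h3 := eta_sub_ne_zero hα.2.symm
    rw [one_div_conj_sub]
    field_simp
    ring
  rw [h1, sum_div_sub_erase_erase h, sum_div_sub_erase_erase h.symm, ← neg_sub (eta N β) (eta N γ)]
  field_simp
  ring

/-- The symmetric part is -(η_β+η_γ)²/(η_β-η_γ)² = -1 - 4η_βη_γ/(η_β-η_γ)², and 1/|η_β-η_γ|² =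
-η_βη_γ/(η_β-η_γ)² on the unit circle. -/
theorem pairSum_add_pairSum {β γ : Fin N} (h : β ≠ γ) :
    pairSum β γ + pairSum γ β =
      4 * (1 / (conj (eta N β) - conj (eta N γ)) * (1 / (eta N β - eta N γ))) - 1 := by
  have hβγ := eta_sub_ne_zero h.symm
  rw [pairSum_of_ne h, pairSum_of_ne h.symm, one_div_conj_sub, ← neg_sub (eta N β) (eta N γ)]
  field_simp
  ring

theorem dotS_self (β : Fin N) : dotS β β = (2 : ℂ) • (1 : Op N) := by
  have h : sz * sz + (1 / 2 : ℂ) • (sp * sm + sm * sp) = (2 : ℂ) • 1 := by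
    have := sqrt_two_mul_self
    ext i j
    fin_cases i <;> fin_cases j <;>
      simp [sp, sm, sz, this] <;> norm_num
  rw [dotS_eq, site_mul, site_mul, site_mul, ← site_add, ← site_smul, ← site_add, h, site_smul,
    site_one]

theorem dotS_comm (β γ : Fin N) : dotS β γ = dotS γ β := by
  rcases eq_or_ne β γ with rfl | h
  · rfl
  · rw [dotS_eq, dotS_eq, site_commute h, site_commute h sp sm, site_commute h sm sp,
      add_comm (site γ sm * _)]

/-- The total spin squared. -/
theorem sum_dotS_mulVec {ψ : State N} (hp : (∑ β, Sp β) *ᵥ ψ = 0) (hm : (∑ β, Sm β) *ᵥ ψ = 0)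
    (hz : (∑ β, Sz β) *ᵥ ψ = 0) : (∑ β, ∑ γ, dotS β γ) *ᵥ ψ = (0 : State N) := by
  have h : (∑ β : Fin N, ∑ γ : Fin N, dotS β γ) = (∑ β, Sz β) * (∑ β, Sz β) +
      (1 / 2 : ℂ) • ((∑ β, Sp β) * (∑ β, Sm β) + (∑ β, Sm β) * (∑ β, Sp β)) := by
    simp only [dotS_eq, Finset.sum_mul_sum, Finset.smul_sum, smul_add, Finset.sum_add_distrib,
      Sz, Sp, Sm]
  rw [h]
  simp only [Matrix.add_mulVec, Matrix.smul_mulVec, ← Matrix.mulVec_mulVec, hp, hm, hz,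
    Matrix.mulVec_zero, add_zero, smul_zero]

theorem sum_envDot (N : ℕ) :
    ∑ α : Fin N, envDot α (fun β => 1 / (conj (eta N α) - conj (eta N β)))
      (fun β => 1 / (eta N α - eta N β)) = ∑ β, ∑ γ, pairSum β γ • dotS β γ := by
  have h : ∀ (α : Fin N) (F : Fin N → Op N),
      ∑ β ∈ Finset.univ.erase α, F β = ∑ β, if α ≠ β then F β else 0 := by
    intro α F
    rw [← Finset.sum_filter]
    exact Finset.sum_congr (by ext; simp [eq_comm]) fun _ _ => rfl
  simp only [envDot_eq, h, pairSum, Finset.sum_smul]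
  rw [Finset.sum_comm]
  refine Finset.sum_congr rfl fun β _ => ?_
  simp only [ite_smul, zero_smul]
  rw [Finset.sum_comm]
  refine Finset.sum_congr rfl fun α _ => ?_
  by_cases hαβ : α ≠ β <;> simp [hαβ]

/-- The coefficients are 4/5 = 1 - 4/20 and 2/5 = 8/20. Symmetrizing `pairSum` produces (2/5)(1/2)·4
= 4/5 times the inverse-square interaction, which cancels the first sum. The constant collects
-2N/5, from completing the total spin squared, and -N(N²-1)/15, from the diagonal of `pairSum`; here
S² = 2 at each site. -/
theorem sum_dotEnv_eq (N : ℕ) :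
    (4 / 5 : ℂ) • ∑ α : Fin N, dotEnv α
        (fun β => 1 / (conj (eta N α) - conj (eta N β)) * (1 / (eta N α - eta N β))) -
      (2 / 5 : ℂ) • ∑ β : Fin N, ∑ γ, pairSum β γ • dotS β γ =
    (1 / 5 : ℂ) • (∑ β : Fin N, ∑ γ, dotS β γ) -
      ((N : ℂ) * (N ^ 2 + 5) / 15) • (1 : Op N) := by
  have hsymm : (∑ β : Fin N, ∑ γ, pairSum β γ • dotS β γ) =
      (1 / 2 : ℂ) • ∑ β : Fin N, ∑ γ, (pairSum β γ + pairSum γ β) • dotS β γ := by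
    have : ∑ β : Fin N, ∑ γ, pairSum γ β • dotS β γ = ∑ β : Fin N, ∑ γ, pairSum β γ • dotS β γ := by
      rw [Finset.sum_comm]
      simp only [dotS_comm]
    simp only [add_smul, Finset.sum_add_distrib, this]
    module
  have hsplit : ∀ F : Fin N → Fin N → Op N, ∑ β, ∑ γ, F β γ =
      (∑ β, F β β) + ∑ β, ∑ γ ∈ Finset.univ.erase β, F β γ := by
    intro F
    rw [← Finset.sum_add_distrib]
    exact Finset.sum_congr rfl fun β _ => (Finset.add_sum_erase _ _ (Finset.mem_univ β)).symm
  rw [hsymm, hsplit fun β γ => (pairSum β γ + pairSum γ β) • dotS β γ, hsplit fun β γ => dotS β γ]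
  have hoff : ∑ β : Fin N, ∑ γ ∈ Finset.univ.erase β, (pairSum β γ + pairSum γ β) • dotS β γ =
      (4 : ℂ) • (∑ α : Fin N, dotEnv α
        (fun β => 1 / (conj (eta N α) - conj (eta N β)) * (1 / (eta N α - eta N β)))) -
      ∑ β : Fin N, ∑ γ ∈ Finset.univ.erase β, dotS β γ := by
    simp only [dotEnv, Finset.smul_sum, ← Finset.sum_sub_distrib]
    refine Finset.sum_congr rfl fun β _ => Finset.sum_congr rfl fun γ hγ => ?_
    rw [pairSum_add_pairSum (Finset.ne_of_mem_erase hγ).symm, sub_smul, one_smul, mul_smul]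
  rw [hoff]
  simp only [pairSum_self, dotS_self, Finset.sum_const, Finset.card_univ, Fintype.card_fin,
    ← Nat.cast_smul_eq_nsmul ℂ]
  module

theorem hamiltonian_mulVec {ψ : State N} (hm : (∑ β, Sm β) *ᵥ ψ = 0)
    (hz : (∑ β, Sz β) *ᵥ ψ = 0) (hΩ : ∀ α, Omega N α *ᵥ ψ = 0)
    (hΩ' : ∀ α, OmegaBar N α *ᵥ ψ = 0) :
    hamiltonian N *ᵥ ψ =
      (2 * (Real.pi : ℂ) ^ 2 / (N : ℂ) ^ 2 * -((N : ℂ) * (N ^ 2 + 5) / 15)) • ψ := by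
  have hp := sum_Sp_mulVec_eq_zero hm hz
  have h := congrArg (fun A : Op N => A *ᵥ ψ) (sum_dotEnv_eq N)
  simp only [Matrix.sub_mulVec, Matrix.smul_mulVec, sum_dotS_mulVec hp hm hz, smul_zero,
    Matrix.one_mulVec, ← sum_envDot, Matrix.sum_mulVec] at h
  rw [hamiltonian_eq, Matrix.smul_mulVec, mul_smul]
  congr 1
  have key := fun α => dotEnv_mul_dotEnv_mulVec hp (w := fun β => 1 / (eta N α - eta N β))
    (w' := fun β => 1 / (conj (eta N α) - conj (eta N β))) (hΩ α) (hΩ' α)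
  simp only [Matrix.sum_mulVec, Matrix.sub_mulVec, Matrix.smul_mulVec, key]
  simp only [Finset.sum_sub_distrib, ← Finset.smul_sum, Finset.sum_add_distrib]
  linear_combination (norm := module) h

end Hamiltonian

end PfaffianChain

theorem mainTheorem6 (n : ℕ) (hn : 0 < n) :
    Module.End.HasEigenvector
        (Matrix.toLin' (PfaffianChain.hamiltonian (2 * n)))
        ((-(2 * Real.pi ^ 2 / 15) * (((2 * n : ℕ) : ℝ) + 5 / ((2 * n : ℕ) : ℝ)) : ℝ) : ℂ)
        (PfaffianChain.psi0 n) ∧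
      (∀ α : Fin (2 * n),
        PfaffianChain.Omega (2 * n) α *ᵥ PfaffianChain.psi0 n = 0 ∧
        PfaffianChain.OmegaBar (2 * n) α *ᵥ PfaffianChain.psi0 n = 0) ∧
      (∀ α : Fin (2 * n),
        PfaffianChain.Xi (2 * n) α *ᵥ PfaffianChain.psi0 n = 0 ∧
        PfaffianChain.XiBar (2 * n) α *ᵥ PfaffianChain.psi0 n = 0) := by
  refine ⟨⟨Module.End.mem_eigenspace_iff.mpr ?_, PfaffianChain.psi0_ne_zero n⟩,
    fun α => ⟨PfaffianChain.Omega_mulVec_psi0 n α, PfaffianChain.OmegaBar_mulVec_psi0 n α⟩,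
    fun α => ⟨PfaffianChain.Xi_mulVec_psi0 n α, PfaffianChain.XiBar_mulVec_psi0 n α⟩⟩
  have hm : (∑ β, PfaffianChain.Sm β) *ᵥ PfaffianChain.psi0 n = 0 := by
    rw [PfaffianChain.psi0_eq_ket]
    exact (PfaffianChain.isLatticePoly_wavePoly n).sum_Sm_mulVec_ket
  have hz : (∑ β, PfaffianChain.Sz β) *ᵥ PfaffianChain.psi0 n = 0 := by
    rw [PfaffianChain.psi0_eq_ket]
    exact PfaffianChain.sum_Sz_mulVec_ket _
  rw [Matrix.toLin'_apply, PfaffianChain.hamiltonian_mulVec hm hz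
    (PfaffianChain.Omega_mulVec_psi0 n) (PfaffianChain.OmegaBar_mulVec_psi0 n)]
  congr 1
  have hN : (n : ℂ) ≠ 0 := Nat.cast_ne_zero.mpr hn.ne'
  push_cast
  field_simp
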